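/- Let $K$ be an algebraically closed field of characteristic zero and let $\omega=(\omega_{ij})_{1\le i,j\le 4}$ be a matrix of elements of $K$ with $\omega_{ij}\omega_{ji}=1$ and $\omega_{ii}=1$ for all $i,j$. Let $V$ be the vector space with basis $X_1,\dots,X_4$, let $S_\omega=K\langle X_1,\dots,X_4\rangle/I$, where $I$ is the two-sided ideal generated by the elements $X_jX_i-\omega_{ij}X_iX_j$, and put $q_{(ijk)}=\omega_{ij}\omega_{jk}\omega_{ki}$. For $i\ge 0$ let $\Omega_i\subseteq\mathbb P(V^*)^i$ be the closed subscheme defined by the multilinear forms $f(p_1,\dots,p_i)$, for $f$ in the degree $i$ part $I_i$ of $I$. The point scheme of $S_\omega$ is the inverse limit, over $K$, of the schemes $\Omega_i$ along the projections $\Omega_j\to\Omega_i$ ($i\le j$) onto the first $i$ factors, and the point variety of $\mathbb P^3_\omega$ is the point scheme with its reduced structure. Then the point scheme exists, and the point variety of $\mathbb P^3_\omega$ is isomorphic over $K$ to the following variety, where $V(\dots)\subseteq\mathbb P^3$ denotes a zero locus with its reduced structure: 1. $\mathbb P^3$ if $q_{(123)}=q_{(124)}=q_{(134)}=1$; 2.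 $V(X_1,X_2)\cup V(X_3)\cup V(X_4)$ (a line and two hyperplanes) if one of the following holds: - $q_{(123)}=q_{(124)}=1$ and $q_{(134)}\ne1$; - $q_{(123)}=q_{(134)}=1$ and $q_{(124)}\ne1$; - $q_{(124)}=q_{(134)}=1$ and $q_{(123)}\ne1$; - $q_{(123)}=1$ and $q_{(124)}=q_{(134)}\ne1$; - $q_{(124)}=1$ and $q_{(123)}=q_{(134)}^{-1}\ne1$; - $q_{(134)}=1$ and $q_{(123)}=q_{(124)}\ne1$; 3. $V(X_1)\cup V(X_2,X_3)\cup V(X_2,X_4)\cup V(X_3,X_4)$ (a hyperplane and three lines) if one of the following holds: - $q_{(123)}=1$, $q_{(124)}\ne1$, $q_{(134)}\ne1$ and $q_{(124)}\ne q_{(134)}$; - $q_{(124)}=1$, $q_{(123)}\ne1$, $q_{(134)}\ne1$ and $q_{(123)}\ne q_{(134)}^{-1}$; - $q_{(134)}=1$, $q_{(123)}\ne1$, $q_{(124)}\ne1$ and $q_{(123)}\ne q_{(124)}$; - $q_{(123)},q_{(124)},q_{(134)}\ne1$ and $q_{(123)}q_{(134)}=q_{(124)}$; 4. $V(X_1,X_2)\cup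 V(X_1,X_3)\cup V(X_1,X_4)\cup V(X_2,X_3)\cup V(X_2,X_4)\cup V(X_3,X_4)$ (six lines) otherwise. -/

import Mathlib

open CategoryTheory CategoryTheory.Limits AlgebraicGeometry Opposite

universe u

noncomputable section

namespace SkewProj

variable (K : Type u) [Field K] (n : ℕ)

/-! ### Projective space over a field, as a scheme over `Spec K` -/

/-- The standard grading of `K[X_1, ..., X_n]`. -/
abbrev grading : ℕ → Submodule K (MvPolynomial (Fin n) K) :=
  MvPolynomial.homogeneousSubmodule (Fin n) K

instance gradedAlgebraGrading : GradedAlgebra (grading K n) :=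
  MvPolynomial.gradedAlgebra

/-- `ℙ^{n-1} = Proj K[X_1, ..., X_n]` as a scheme over `Spec K`.  With `V` the span of the `X_i`,
this is `ℙ(V^*)`. -/
def projSpace : Over (Spec (.of K)) :=
  Over.mk (Proj.toSpecZero (grading K n) ≫
    Spec.map (CommRingCat.ofHom (algebraMap K (grading K n 0))))

/-- The standard open `X_a ≠ 0` of projective space. -/
def chart (a : Fin n) : (projSpace K n).left.Opens :=
  Proj.basicOpen (grading K n) (MvPolynomial.X a)

theorem X_mem_grading (j : Fin n) : MvPolynomial.X j ∈ grading K n 1 :=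
  (MvPolynomial.mem_homogeneousSubmodule 1 _).2 (MvPolynomial.isHomogeneous_X K j)

theorem X_mem_grading_smul (j : Fin n) : MvPolynomial.X j ∈ grading K n (1 • 1) :=
  X_mem_grading K n j

/-- The regular function `X_j / X_a` on the standard open `X_a ≠ 0`. -/
def ratio (a j : Fin n) : Γ((projSpace K n).left, chart K n a) :=
  (Proj.awayToSection (grading K n) (MvPolynomial.X a)).hom
    (HomogeneousLocalization.Away.mk (grading K n) (X_mem_grading K n a) 1
      (MvPolynomial.X j) (X_mem_grading_smul K n j))

variable {K} {n}

/-- The structure map `K → Γ(T, U)` of a scheme `T` over `Spec K`. -/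
def scalar (T : Over (Spec (.of K))) (U : T.left.Opens) : K →+* Γ(T.left, U) :=
  (T.hom.appLE ⊤ U le_top).hom.comp (Scheme.ΓSpecIso (.of K)).inv.hom

/-! ### Zeros of multilinear forms -/

/-- The degree `i` part of the free algebra on `n` generators of degree one. -/
def degreePart (i : ℕ) : Submodule K (FreeAlgebra K (Fin n)) :=
  (Submodule.span K (Set.range (FreeAlgebra.ι K))) ^ i

/-- The coefficient of the word `X_{w 1} ⋯ X_{w i}` in a noncommutative polynomial. -/
def wordCoeff {i : ℕ} (f : FreeAlgebra K (Fin n)) (w : Fin i → Fin n) : K :=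
  (FreeAlgebra.equivMonoidAlgebraFreeMonoid f).coeff (FreeMonoid.ofList (List.ofFn w))

/-- The value of the multilinear form given by a noncommutative form `f` of degree `i` on an
`i`-tuple of `T`-points `t k` of projective space, over an open `U` of `T` which each `t k` maps
into the standard open `X_{a k} ≠ 0`.  There `t k` has the coordinates `X_j / X_{a k}`, and
`X_{w 1} ⋯ X_{w i}` is sent to the product over `k` of the `w k`-th coordinate of `t k`. -/
def evalForm {T : Over (Spec (.of K))} {i : ℕ} (t : Fin i → (T ⟶ projSpace K n))
    (f : FreeAlgebra K (Fin n)) (U : T.left.Opens) (a : Fin i → Fin n)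
    (h : ∀ k, U ≤ (t k).left ⁻¹ᵁ chart K n (a k)) : Γ(T.left, U) :=
  ∑ w : Fin i → Fin n, scalar T U (wordCoeff f w) *
    ∏ k, ((t k).left.appLE (chart K n (a k)) U (h k)).hom (ratio K n (a k) (w k))

/-- `f(t_1, ..., t_i) = 0` for all `f` in the degree `i` part `I_i` of `I`: the condition that an
`i`-tuple of `T`-points of projective space is a `T`-point of `Ω_i`. -/
def Vanishes (I : TwoSidedIdeal (FreeAlgebra K (Fin n))) {T : Over (Spec (.of K))} {i : ℕ}
    (t : Fin i → (T ⟶ projSpace K n)) : Prop :=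
  ∀ f ∈ I, f ∈ degreePart i → ∀ (U : T.left.Opens) (a : Fin i → Fin n)
    (h : ∀ k, U ≤ (t k).left ⁻¹ᵁ chart K n (a k)), evalForm t f U a h = 0

/-- The scheme `Z`, with the coordinate projections `p`, is the scheme
`Ω_i = {(p_1, ..., p_i) ∈ ℙ(V^*)^i : f(p_1, ..., p_i) = 0 for all f ∈ I_i}`: the morphisms
`T ⟶ Z` are the `i`-tuples of morphisms `T ⟶ ℙ(V^*)` on which the forms in `I_i` vanish. -/
structure IsOmega (I : TwoSidedIdeal (FreeAlgebra K (Fin n))) {i : ℕ} {Z : Over (Spec (.of K))}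
    (p : Fin i → (Z ⟶ projSpace K n)) : Prop where
  vanishes : Vanishes I p
  existsUnique_lift : ∀ (T : Over (Spec (.of K))) (t : Fin i → (T ⟶ projSpace K n)),
    Vanishes I t → ∃! g : T ⟶ Z, ∀ k, g ≫ p k = t k

/-- The inverse system of the schemes `Ω_i`, with the projections `Ω_j ⟶ Ω_i` onto the first `i`
coordinates as transition maps. -/
structure OmegaSystem (I : TwoSidedIdeal (FreeAlgebra K (Fin n))) where
  Ω : ℕᵒᵖ ⥤ Over (Spec (.of K))
  p : ∀ i : ℕ, Fin i → (Ω.obj (op i) ⟶ projSpace K n)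
  isOmega : ∀ i, IsOmega I (p i)
  pr_p : ∀ (i j : ℕ) (h : i ≤ j) (k : Fin i),
    Ω.map (homOfLE h).op ≫ p i k = p j (Fin.castLE h k)

/-! ### Reduced structures and the point variety -/

/-- A closed subset `Z` of a scheme over `Spec K`, with its reduced induced structure. -/
def reducedOn (X : Over (Spec (.of K))) (Z : TopologicalSpace.Closeds X.left) :
    Over (Spec (.of K)) :=
  Over.mk ((Scheme.IdealSheafData.vanishingIdeal Z).subschemeι ≫ X.hom)

/-- `Y` is isomorphic over `K` to the point variety of `K⟨X_1, ..., X_n⟩ / I`: the point scheme,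
i.e. the inverse limit of the system of the `Ω_i`, exists, and `Y` is isomorphic to it with its
reduced structure. -/
def IsPointVariety (I : TwoSidedIdeal (FreeAlgebra K (Fin n))) (Y : Over (Spec (.of K))) : Prop :=
  ∃ (S : OmegaSystem I) (c : Cone S.Ω), Nonempty (IsLimit c) ∧ Nonempty (Y ≅ reducedOn c.pt ⊤)

/-- The linear subspace `V(X_j : j ∈ s)` of projective space, as a closed subset. -/
def linearLocus (s : Set (Fin n)) : TopologicalSpace.Closeds (projSpace K n).left :=
  ⟨ProjectiveSpectrum.zeroLocus (grading K n) (MvPolynomial.X '' s),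
    ProjectiveSpectrum.isClosed_zeroLocus (grading K n) _⟩

/-! ### The algebras `S_ω` -/

/-- The ideal `I` with `S_ω = K⟨X_1, ..., X_n⟩ / I`, generated by the `X_j X_i - ω_{ij} X_i X_j`. -/
def skewIdeal (ω : Fin n → Fin n → K) : TwoSidedIdeal (FreeAlgebra K (Fin n)) :=
  TwoSidedIdeal.span {f | ∃ i j : Fin n, f =
    FreeAlgebra.ι K j * FreeAlgebra.ι K i - ω i j • (FreeAlgebra.ι K i * FreeAlgebra.ι K j)}

/-- The cyclic `q`-number `q_{(ijk)}(ω)` of the 3-cycle `(i j k)`. -/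
def qNumber (ω : Fin n → Fin n → K) (i j k : Fin n) : K := ω i j * ω j k * ω k i

/-- The condition on `q_{(123)}, q_{(124)}, q_{(134)}` for a line and two hyperplanes. -/
def LineTwoHyperplanes (q₁₂₃ q₁₂₄ q₁₃₄ : K) : Prop :=
  (q₁₂₃ = 1 ∧ q₁₂₄ = 1 ∧ q₁₃₄ ≠ 1) ∨
  (q₁₂₃ = 1 ∧ q₁₃₄ = 1 ∧ q₁₂₄ ≠ 1) ∨
  (q₁₂₄ = 1 ∧ q₁₃₄ = 1 ∧ q₁₂₃ ≠ 1) ∨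
  (q₁₂₃ = 1 ∧ q₁₂₄ = q₁₃₄ ∧ q₁₃₄ ≠ 1) ∨
  (q₁₂₄ = 1 ∧ q₁₂₃ = q₁₃₄⁻¹ ∧ q₁₃₄⁻¹ ≠ 1) ∨
  (q₁₃₄ = 1 ∧ q₁₂₃ = q₁₂₄ ∧ q₁₂₄ ≠ 1)

/-- The condition on `q_{(123)}, q_{(124)}, q_{(134)}` for a hyperplane and three lines. -/
def HyperplaneThreeLines (q₁₂₃ q₁₂₄ q₁₃₄ : K) : Prop :=
  (q₁₂₃ = 1 ∧ q₁₂₄ ≠ 1 ∧ q₁₂₄ ≠ q₁₃₄ ∧ q₁₃₄ ≠ 1) ∨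
  (q₁₂₄ = 1 ∧ q₁₂₃ ≠ 1 ∧ q₁₂₃ ≠ q₁₃₄⁻¹ ∧ q₁₃₄⁻¹ ≠ 1) ∨
  (q₁₃₄ = 1 ∧ q₁₂₃ ≠ 1 ∧ q₁₂₃ ≠ q₁₂₄ ∧ q₁₂₄ ≠ 1) ∨
  (q₁₂₃ ≠ 1 ∧ q₁₂₄ ≠ 1 ∧ q₁₃₄ ≠ 1 ∧ q₁₂₃ * q₁₃₄ = q₁₂₄)

end SkewProj

end

/-! The ideal is generated in degree two, so its forms of degree $i$ vanish on $(p_1,\dots,p_i)$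
exactly when every consecutive pair $(x,x')$ satisfies $x_jx'_i=\omega_{ij}x_ix'_j$
(`vanishes_of_related`, `Vanishes.related`). Where $x_a=1$ these equations force $x'_a$ to be
invertible, and normalising $x'_a=1$ gives $x'_i=\omega_{ia}x_i$: a point has at most one successor
(`Related.right_unique`). Substituting back leaves $(\omega_{ia}-\omega_{ij}\omega_{ja})x_ix_j=0$,
whose coefficient vanishes only if $q_{(ija)}=1$. Hence a point has a successor if and only if all
cubics $x_ix_jx_k$ with $q_{(ijk)}\ne1$ vanish on it (`Related.cubicsVanish`,
`CubicsVanish.exists_related`), and the successor satisfies the same cubics.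

All this holds for $T$-points over any base. Let $E$ be the closed subscheme cut out by the cubics
(`exists_cubicScheme`). For $i\ge2$ the first coordinate identifies $\Omega_i$ with $E$, so the
point scheme exists and equals $E$. Its reduced structure depends only on the underlying closed set
(`isPointVariety_of_isCubicLocus`).

In $\mathbb P^3$ only the four 3-subsets of indices matter. The cocycle identity
$q_{(234)}q_{(124)}=q_{(123)}q_{(134)}$ (`qNumber_mul_qNumber`) excludes exactly one $q$ being
different from $1$. The number of nontrivial $q$'s is thus 0, 2, 3 or 4, which gives the four shapes
up to permuting coordinates (`isPointVariety_of_perm`). -/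

noncomputable section

namespace SkewProj

/-! ### The ring of functions on a standard open -/

section Away

variable {K : Type u} [Field K] {n : ℕ}

/-- The structure map of the degree zero part of `K[X_1, ..., X_n, 1 / X_a]`. -/
def awayScalar (a : Fin n) :
    K →+* HomogeneousLocalization.Away (grading K n) (MvPolynomial.X a) :=
  (HomogeneousLocalization.fromZeroRingHom (grading K n) _).comp (algebraMap K (grading K n 0))

/-- The element `X_j / X_a` of the degree zero part of `K[X_1, ..., X_n, 1 / X_a]`. -/
def awayRatio (a j : Fin n) : HomogeneousLocalization.Away (grading K n) (MvPolynomial.X a) :=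
  HomogeneousLocalization.Away.mk (grading K n) (X_mem_grading K n a) 1
    (MvPolynomial.X j) (X_mem_grading_smul K n j)

theorem val_awayScalar (a : Fin n) (r : K) : (awayScalar a r).val =
    algebraMap (MvPolynomial (Fin n) K) (Localization.Away (MvPolynomial.X a))
      (MvPolynomial.C r) := by
  exact Localization.mk_one_eq_algebraMap _

theorem val_awayRatio (a j : Fin n) : (awayRatio (K := K) a j).val =
    Localization.mk (MvPolynomial.X j) ⟨MvPolynomial.X a, Submonoid.mem_powers _⟩ := by
  simp [awayRatio, HomogeneousLocalization.Away.val_mk]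

theorem algebraMap_X_eq (a j : Fin n) :
    algebraMap (MvPolynomial (Fin n) K) (Localization.Away (MvPolynomial.X a))
      (MvPolynomial.X j) =
    algebraMap (MvPolynomial (Fin n) K) (Localization.Away (MvPolynomial.X a)) (MvPolynomial.X a) * (awayRatio (K := K) a j).val := by
  rw [val_awayRatio, ← Localization.mk_one_eq_algebraMap, ← Localization.mk_one_eq_algebraMap,
    Localization.mk_mul, Localization.mk_eq_mk_iff, Localization.r_iff_exists]
  exact ⟨1, by simp [mul_comm]⟩

theorem awayRatio_self (a : Fin n) : awayRatio (K := K) a a = 1 := by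
  ext
  rw [val_awayRatio, HomogeneousLocalization.val_one]
  exact Localization.mk_self ⟨MvPolynomial.X a, Submonoid.mem_powers _⟩

/-- Dehomogenisation: each variable is $X_a\cdot(X_i/X_a)$, and every monomial of a form of degree
$k$ contributes the same power $X_a^k$. -/
theorem algebraMap_eq_pow_mul_eval₂ (a : Fin n) (k : ℕ) (g : MvPolynomial (Fin n) K)
    (hg : g ∈ grading K n k) :
    algebraMap (MvPolynomial (Fin n) K) (Localization.Away (MvPolynomial.X a)) g =
      algebraMap (MvPolynomial (Fin n) K) (Localization.Away (MvPolynomial.X a)) (MvPolynomial.X a) ^ k *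
        (MvPolynomial.eval₂ (awayScalar a) (awayRatio a) g).val := by
  have hg' := (MvPolynomial.mem_homogeneousSubmodule _ _).1 hg
  have h1 : (MvPolynomial.eval₂ (awayScalar a) (awayRatio a) g).val =
      MvPolynomial.eval₂ ((algebraMap (MvPolynomial (Fin n) K)
        (Localization.Away (MvPolynomial.X a))).comp MvPolynomial.C)
        (fun j => (awayRatio (K := K) a j).val) g := by
    have := MvPolynomial.hom_eval₂ g (awayScalar a) (algebraMap
      (HomogeneousLocalization.Away (grading K n) (MvPolynomial.X a))
      (Localization.Away (MvPolynomial.X a : MvPolynomial (Fin n) K))) (awayRatio (K := K) a)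
    rw [HomogeneousLocalization.algebraMap_apply] at this
    rw [this]
    congr 1
  conv_lhs => rw [← MvPolynomial.eval₂_eta g, MvPolynomial.hom_eval₂]
  rw [h1, MvPolynomial.eval₂_eq, MvPolynomial.eval₂_eq, Finset.mul_sum]
  refine Finset.sum_congr rfl fun d hd => ?_
  have hdk : ∑ i ∈ d.support, d i = k := by
    rw [← hg' (MvPolynomial.mem_support_iff.1 hd), Finsupp.weight_apply, Finsupp.sum]
    simp
  rw [← hdk, ← Finset.prod_pow_eq_pow_sum, mul_left_comm, ← Finset.prod_mul_distrib]
  congr 1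
  refine Finset.prod_congr rfl fun i _ => ?_
  rw [algebraMap_X_eq a i, mul_pow]

theorem eval₂_away_surjective (a : Fin n) : Function.Surjective
    (MvPolynomial.eval₂Hom (awayScalar (K := K) a) (awayRatio a)) := by
  intro z
  obtain ⟨k, g, hg, rfl⟩ := HomogeneousLocalization.Away.mk_surjective (grading K n)
    (X_mem_grading K n a) z
  refine ⟨g, ?_⟩
  ext
  rw [HomogeneousLocalization.Away.val_mk, MvPolynomial.coe_eval₂Hom]
  have hu : IsUnit (algebraMap (MvPolynomial (Fin n) K)
      (Localization.Away (MvPolynomial.X a)) (MvPolynomial.X a) ^ k) :=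
    (IsLocalization.Away.algebraMap_isUnit (S := Localization.Away
      (MvPolynomial.X a : MvPolynomial (Fin n) K)) (MvPolynomial.X a)).pow k
  refine hu.mul_left_cancel ?_
  rw [← algebraMap_eq_pow_mul_eval₂ a k g (by simpa using hg), ← map_pow,
    ← Localization.mk_one_eq_algebraMap, ← Localization.mk_one_eq_algebraMap,
    Localization.mk_mul, Localization.mk_eq_mk_iff, Localization.r_iff_exists]
  exact ⟨1, by simp [mul_comm]⟩

theorem away_ringHom_ext {R : Type*} [CommRing R] (a : Fin n)
    (φ ψ : HomogeneousLocalization.Away (grading K n) (MvPolynomial.X a) →+* R)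
    (h1 : ∀ r, φ (awayScalar a r) = ψ (awayScalar a r))
    (h2 : ∀ j, φ (awayRatio a j) = ψ (awayRatio a j)) : φ = ψ := by
  have : φ.comp (MvPolynomial.eval₂Hom (awayScalar (K := K) a) (awayRatio a)) =
      ψ.comp (MvPolynomial.eval₂Hom (awayScalar (K := K) a) (awayRatio a)) :=
    MvPolynomial.ringHom_ext (by simpa using h1) (by simpa using h2)
  ext z
  obtain ⟨g, rfl⟩ := eval₂_away_surjective a z
  exact DFunLike.congr_fun this g

/-- Evaluation at $x$ sends $X_a$ to $1$, hence extends to the localization; its restriction to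
degree zero sends $X_j/X_a$ to $x_j$. With `away_ringHom_ext` this is the universal property of the
chart ring. -/
theorem exists_away_ringHom {R : Type*} [CommRing R] (a : Fin n) (c : K →+* R) (x : Fin n → R)
    (hx : x a = 1) :
    ∃ φ : HomogeneousLocalization.Away (grading K n) (MvPolynomial.X a) →+* R,
      (∀ r, φ (awayScalar a r) = c r) ∧ ∀ j, φ (awayRatio a j) = x j := by
  have hu : IsUnit (MvPolynomial.eval₂Hom c x (MvPolynomial.X a)) := by simp [hx]
  let L : Localization.Away (MvPolynomial.X a : MvPolynomial (Fin n) K) →+* R :=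
    IsLocalization.Away.lift (MvPolynomial.X a) hu
  have hL : ∀ g, L (algebraMap _ _ g) = MvPolynomial.eval₂Hom c x g :=
    IsLocalization.Away.lift_eq (MvPolynomial.X a) hu
  refine ⟨L.comp (algebraMap _ _), fun r => ?_, fun j => ?_⟩
  · simp [HomogeneousLocalization.algebraMap_apply, val_awayScalar, hL]
  · have := congrArg L (algebraMap_X_eq (K := K) a j)
    rw [map_mul, hL, hL] at this
    simpa [HomogeneousLocalization.algebraMap_apply, hx] using this.symm

end Away

/-! ### Morphisms to an affine open -/

section AffineTarget

variable {X Y : Scheme.{u}}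

theorem ι_comp_eq_of_isAffineOpen (f : X ⟶ Y) {V : Y.Opens} (hV : IsAffineOpen V) {U : X.Opens}
    (h : U ≤ f ⁻¹ᵁ V) :
    U.ι ≫ f = U.toSpecΓ ≫ Spec.map (f.appLE V U h) ≫ hV.fromSpec := by
  rw [Scheme.Opens.toSpecΓ_SpecMap_appLE_assoc, hV.toSpecΓ_fromSpec, Scheme.Hom.resLE_comp_ι]

/-- The morphism to an affine open given by a homomorphism of its ring of functions. -/
def toAffineOpen {V : Y.Opens} (hV : IsAffineOpen V) (ψ : Γ(Y, V) ⟶ Γ(X, ⊤)) : X ⟶ Y :=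
  X.toSpecΓ ≫ Spec.map ψ ≫ hV.fromSpec

theorem le_preimage_toAffineOpen {V : Y.Opens} (hV : IsAffineOpen V) (ψ : Γ(Y, V) ⟶ Γ(X, ⊤)) :
    ⊤ ≤ toAffineOpen hV ψ ⁻¹ᵁ V := by
  rw [toAffineOpen, Scheme.Hom.comp_preimage, Scheme.Hom.comp_preimage, hV.fromSpec_preimage_self]
  rfl

theorem toAffineOpen_appLE {V : Y.Opens} (hV : IsAffineOpen V) (ψ : Γ(Y, V) ⟶ Γ(X, ⊤))
    (h : ⊤ ≤ toAffineOpen hV ψ ⁻¹ᵁ V) : (toAffineOpen hV ψ).appLE V ⊤ h = ψ := by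
  have h1 : hV.fromSpec.appLE V ⊤ hV.fromSpec_preimage_self.ge =
      (Scheme.ΓSpecIso Γ(Y, V)).inv := by
    rw [Scheme.Hom.appLE, hV.fromSpec_app_self, Category.assoc, ← Functor.map_comp]
    exact (congrArg _ (CategoryTheory.Functor.map_id _ _)).trans (Category.comp_id _)
  have h2 : (X.toSpecΓ ≫ Spec.map ψ).appLE ⊤ ⊤ le_top = (Scheme.ΓSpecIso Γ(Y, V)).hom ≫ ψ := by
    refine (Scheme.Hom.appLE_eq_app (X.toSpecΓ ≫ Spec.map ψ)).trans ?_
    change (X.toSpecΓ ≫ Spec.map ψ).appTop = _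
    rw [Scheme.Hom.comp_appTop, Scheme.toSpecΓ_appTop, Scheme.ΓSpecIso_naturality]
  have h3 := Scheme.Hom.appLE_comp_appLE (X.toSpecΓ ≫ Spec.map ψ) hV.fromSpec V ⊤ ⊤
    hV.fromSpec_preimage_self.ge le_top
  rw [h1, h2, Iso.inv_hom_id_assoc] at h3
  simpa only [toAffineOpen, Category.assoc] using h3.symm

end AffineTarget

end SkewProj

namespace SkewProj

variable {K : Type u} [Field K] {n : ℕ}

/-! ### The standard opens of projective space -/

theorem isAffineOpen_chart (a : Fin n) : IsAffineOpen (chart K n a) :=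
  Proj.isAffineOpen_basicOpen (grading K n) _ (X_mem_grading K n a) one_pos

theorem iSup_chart : ⨆ a, chart K n a = ⊤ := by
  refine Proj.iSup_basicOpen_eq_top' (grading K n) MvPolynomial.X
    (fun i => ⟨1, X_mem_grading K n i⟩) ?_
  refine top_le_iff.1 fun p _ => ?_
  have hp : p ∈ Algebra.adjoin K (Set.range (MvPolynomial.X : Fin n → MvPolynomial (Fin n) K)) := by
    rw [MvPolynomial.adjoin_range_X]
    trivial
  induction hp using Algebra.adjoin_induction with
  | mem x hx => exact Algebra.subset_adjoin hx
  | algebraMap r =>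
    exact Subalgebra.algebraMap_mem _ (algebraMap K (grading K n 0) r)
  | add x y _ _ hx hy => exact add_mem (hx trivial) (hy trivial)
  | mul x y _ _ hx hy => exact mul_mem (hx trivial) (hy trivial)

theorem exists_mem_chart (x : (projSpace K n).left) : ∃ a, x ∈ chart K n a := by
  have : x ∈ ⨆ a, chart K n a := by rw [iSup_chart]; trivial
  exact TopologicalSpace.Opens.mem_iSup.1 this

theorem ι_comp_eq_of_appLE {X : Scheme.{u}} {R : CommRingCat.{u}} (f : X ⟶ Spec R) (U : X.Opens) :
    U.ι ≫ f = U.toSpecΓ ≫ Spec.map ((Scheme.ΓSpecIso R).inv ≫ f.appLE ⊤ U le_top) := by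
  rw [ι_comp_eq_of_isAffineOpen f (isAffineOpen_top (Spec R)) le_top, Spec.map_comp,
    IsAffineOpen.fromSpec_top]
  simp

theorem eq_of_toSpecΓ_comp_eq {X : Scheme.{u}} {R : CommRingCat.{u}} (U : X.Opens)
    (φ ψ : R ⟶ Γ(X, U)) (h : U.toSpecΓ ≫ Spec.map φ = U.toSpecΓ ≫ Spec.map ψ) : φ = ψ := by
  have := congrArg Scheme.Hom.appTop h
  rw [Scheme.Hom.comp_appTop, Scheme.Hom.comp_appTop, Scheme.Opens.toSpecΓ_appTop,
    Scheme.ΓSpecIso_naturality_assoc, Scheme.ΓSpecIso_naturality_assoc, cancel_epi] at this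
  exact (cancel_mono _).1 this

/-- The constants coming from the structure morphism to $\operatorname{Spec}K$ agree with the
algebraic constants of degree zero, so the universal property of the chart ring can be used over
$K$. -/
theorem scalar_chart (a : Fin n) (r : K) :
    scalar (projSpace K n) (chart K n a) r =
      (Proj.awayToSection (grading K n) (MvPolynomial.X a)).hom (awayScalar a r) := by
  have key : (Scheme.ΓSpecIso (.of K)).inv ≫ (projSpace K n).hom.appLE ⊤ (chart K n a) le_top =
      CommRingCat.ofHom (awayScalar a) ≫
        Proj.awayToSection (grading K n) (MvPolynomial.X a) := by
    apply eq_of_toSpecΓ_comp_eq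
    rw [← ι_comp_eq_of_appLE]
    have h := Proj.awayι_toSpecZero (grading K n) _ (X_mem_grading K n a) one_pos
    rw [Proj.awayι, Category.assoc, Iso.inv_comp_eq, Proj.basicOpenIsoSpec_hom] at h
    refine (Category.assoc (Proj.basicOpen (grading K n) (MvPolynomial.X a)).ι
      (Proj.toSpecZero (grading K n)) _).symm.trans ?_
    refine (congrArg (· ≫ Spec.map (CommRingCat.ofHom (algebraMap K (grading K n 0)))) h).trans ?_
    rw [Proj.basicOpenToSpec, Category.assoc, Category.assoc, ← Spec.map_comp, ← Spec.map_comp]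
    rfl
  exact DFunLike.congr_fun (congrArg CommRingCat.Hom.hom key) r

theorem ratio_eq (a j : Fin n) : ratio K n a j =
    (Proj.awayToSection (grading K n) (MvPolynomial.X a)).hom (awayRatio a j) := rfl

theorem chart_hom_ext {R : CommRingCat.{u}} (a : Fin n)
    (φ ψ : Γ((projSpace K n).left, chart K n a) ⟶ R)
    (h1 : ∀ r, φ.hom (scalar _ _ r) = ψ.hom (scalar _ _ r))
    (h2 : ∀ j, φ.hom (ratio K n a j) = ψ.hom (ratio K n a j)) : φ = ψ := by
  refine (cancel_epi (Proj.basicOpenIsoAway (grading K n) _ (X_mem_grading K n a) one_pos).hom).1 ?_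
  rw [Proj.basicOpenIsoAway_hom]
  ext1
  apply away_ringHom_ext
  · intro r
    have := h1 r
    rw [scalar_chart] at this
    exact this
  · exact h2

theorem exists_chart_hom {R : CommRingCat.{u}} (a : Fin n) (c : K →+* R) (x : Fin n → R)
    (hx : x a = 1) : ∃ φ : Γ((projSpace K n).left, chart K n a) ⟶ R,
      (∀ r, φ.hom (scalar _ _ r) = c r) ∧ ∀ j, φ.hom (ratio K n a j) = x j := by
  obtain ⟨φ, h1, h2⟩ := exists_away_ringHom a c x hx
  let e := Proj.basicOpenIsoAway (grading K n) _ (X_mem_grading K n a) one_pos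
  have he : ∀ z, e.inv.hom ((Proj.awayToSection (grading K n) (MvPolynomial.X a)).hom z) = z :=
    fun z => DFunLike.congr_fun (congrArg CommRingCat.Hom.hom e.hom_inv_id) z
  refine ⟨e.inv ≫ CommRingCat.ofHom φ, fun r => ?_, fun j => ?_⟩
  · rw [scalar_chart, ← h1]
    exact congrArg φ (he _)
  · rw [ratio_eq, ← h2]
    exact congrArg φ (he _)

theorem ratio_self (a : Fin n) : ratio K n a a = 1 := by
  rw [ratio_eq, awayRatio_self, map_one]
  rfl

theorem awayMap_ratio_mul (a b j : Fin n) :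
    HomogeneousLocalization.awayMap (grading K n) (X_mem_grading K n b) rfl (awayRatio a b) *
      HomogeneousLocalization.awayMap (grading K n) (X_mem_grading K n a)
        (mul_comm (MvPolynomial.X a : MvPolynomial (Fin n) K) _) (awayRatio b j) =
      HomogeneousLocalization.awayMap (grading K n) (X_mem_grading K n b) rfl (awayRatio a j) := by
  simp only [awayRatio, HomogeneousLocalization.awayMap_mk]
  ext
  rw [HomogeneousLocalization.val_mul, HomogeneousLocalization.Away.val_mk,
    HomogeneousLocalization.Away.val_mk, HomogeneousLocalization.Away.val_mk,
    Localization.mk_mul, Localization.mk_eq_mk_iff, Localization.r_iff_exists]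
  refine ⟨1, ?_⟩
  simp only [Submonoid.coe_mul, Submonoid.coe_one]
  ring

theorem hom_comp_mul_eq {A B C D : CommRingCat.{u}} (α : A ⟶ C) (β : B ⟶ C) (Φ : C ⟶ D)
    (x z : A) (y : B) (h : α.hom x * β.hom y = α.hom z) :
    (α ≫ Φ).hom x * (β ≫ Φ).hom y = (α ≫ Φ).hom z := by
  simp [← h]

theorem toSpecΓ_comp_preimage_basicOpen {X : Scheme.{u}} (U : X.Opens) {R : CommRingCat.{u}}
    (φ : R ⟶ Γ(X, U)) (z : R) :
    (U.toSpecΓ ≫ Spec.map φ) ⁻¹ᵁ PrimeSpectrum.basicOpen z = U.ι ⁻¹ᵁ X.basicOpen (φ.hom z) :=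
  U.toSpecΓ_preimage_basicOpen _

theorem awayToSection_ratio_mul (a b j : Fin n) (U : (Proj (grading K n)).Opens)
    (ha : U ≤ Proj.basicOpen (grading K n) (MvPolynomial.X a))
    (hb : U ≤ Proj.basicOpen (grading K n) (MvPolynomial.X b)) :
    (Proj.awayToSection (grading K n) (MvPolynomial.X a) ≫
        (Proj (grading K n)).presheaf.map (homOfLE ha).op).hom (awayRatio a b) *
      (Proj.awayToSection (grading K n) (MvPolynomial.X b) ≫
        (Proj (grading K n)).presheaf.map (homOfLE hb).op).hom (awayRatio b j) =
      (Proj.awayToSection (grading K n) (MvPolynomial.X a) ≫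
        (Proj (grading K n)).presheaf.map (homOfLE ha).op).hom (awayRatio a j) := by
  have hab : U ≤ Proj.basicOpen (grading K n)
      (MvPolynomial.X a * MvPolynomial.X b : MvPolynomial (Fin n) K) := by
    rw [Proj.basicOpen_mul]
    exact le_inf ha hb
  have h1 : Proj.awayToSection (grading K n) (MvPolynomial.X a) ≫
      (Proj (grading K n)).presheaf.map (homOfLE ha).op =
      CommRingCat.ofHom (HomogeneousLocalization.awayMap (grading K n) (X_mem_grading K n b) rfl) ≫
        Proj.awayToSection (grading K n) (MvPolynomial.X a * MvPolynomial.X b) ≫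
        (Proj (grading K n)).presheaf.map (homOfLE hab).op := by
    rw [Proj.awayMap_awayToSection_assoc (grading K n) (f := MvPolynomial.X a)
      (X_mem_grading K n b) rfl, ← Functor.map_comp]
    rfl
  have h2 : Proj.awayToSection (grading K n) (MvPolynomial.X b) ≫
      (Proj (grading K n)).presheaf.map (homOfLE hb).op =
      CommRingCat.ofHom (HomogeneousLocalization.awayMap (grading K n) (X_mem_grading K n a)
        (mul_comm (MvPolynomial.X a : MvPolynomial (Fin n) K) _)) ≫
        Proj.awayToSection (grading K n) (MvPolynomial.X a * MvPolynomial.X b) ≫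
        (Proj (grading K n)).presheaf.map (homOfLE hab).op := by
    rw [Proj.awayMap_awayToSection_assoc (grading K n) (f := MvPolynomial.X b)
      (X_mem_grading K n a) (mul_comm (MvPolynomial.X a : MvPolynomial (Fin n) K) _),
      ← Functor.map_comp]
    rfl
  rw [h1, h2]
  exact hom_comp_mul_eq _ _ _ _ _ _ (awayMap_ratio_mul a b j)

theorem ratio_mul_ratio (a b j : Fin n) (U : (projSpace K n).left.Opens) (ha : U ≤ chart K n a)
    (hb : U ≤ chart K n b) :
    (projSpace K n).left.presheaf.map (homOfLE ha).op (ratio K n a b) *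
      (projSpace K n).left.presheaf.map (homOfLE hb).op (ratio K n b j) =
      (projSpace K n).left.presheaf.map (homOfLE ha).op (ratio K n a j) :=
  awayToSection_ratio_mul a b j U ha hb

theorem ι_preimage_basicOpen_awayRatio (a b : Fin n) :
    (Proj.basicOpen (grading K n) (MvPolynomial.X a)).ι ⁻¹ᵁ
      Proj.basicOpen (grading K n) (MvPolynomial.X b) =
    (Proj.basicOpen (grading K n) (MvPolynomial.X a)).ι ⁻¹ᵁ (Proj (grading K n)).basicOpen
      ((Proj.awayToSection (grading K n) (MvPolynomial.X a)).hom (awayRatio a b)) := by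
  have h := Proj.awayι_preimage_basicOpen (grading K n) (X_mem_grading K n a) one_pos
    (X_mem_grading K n b) one_pos
  have hz : HomogeneousLocalization.Away.isLocalizationElem (X_mem_grading K n a)
      (X_mem_grading K n b) = awayRatio a b := by
    ext
    simp [HomogeneousLocalization.Away.isLocalizationElem, awayRatio]
  rw [hz] at h
  have h' : Proj.basicOpenToSpec (grading K n) (MvPolynomial.X a) ⁻¹ᵁ
      (Proj.awayι (grading K n) _ (X_mem_grading K n a) one_pos ⁻¹ᵁ
        Proj.basicOpen (grading K n) (MvPolynomial.X b)) =
      (Proj.basicOpen (grading K n) (MvPolynomial.X a)).ι ⁻¹ᵁ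
        Proj.basicOpen (grading K n) (MvPolynomial.X b) := by
    rw [← Scheme.Hom.comp_preimage, Proj.awayι, ← Proj.basicOpenIsoSpec_hom _ _
      (X_mem_grading K n a) one_pos, Iso.hom_inv_id_assoc]
  rw [← h', h]
  exact toSpecΓ_comp_preimage_basicOpen _ (Proj.awayToSection (grading K n) (MvPolynomial.X a)) _

theorem basicOpen_ratio (a b : Fin n) :
    (projSpace K n).left.basicOpen (ratio K n a b) = chart K n a ⊓ chart K n b := by
  have h := congrArg (fun U => (chart K n a).ι ''ᵁ U) (ι_preimage_basicOpen_awayRatio (K := K) a b)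
  have h' : (chart K n a).ι ''ᵁ (chart K n a).ι ⁻¹ᵁ chart K n b = (chart K n a).ι ''ᵁ
      (chart K n a).ι ⁻¹ᵁ (projSpace K n).left.basicOpen (ratio K n a b) := h
  rw [Scheme.Hom.image_preimage_eq_opensRange_inf, Scheme.Hom.image_preimage_eq_opensRange_inf,
    Scheme.Opens.opensRange_ι] at h'
  rw [h']
  exact (inf_eq_right.2 (Scheme.basicOpen_le _ _)).symm

end SkewProj

namespace SkewProj

variable {K : Type u} [Field K] {n : ℕ}

/-! ### Coordinates of points of projective space -/

theorem appLE_congr_hom {X Y : Scheme.{u}} {f g : X ⟶ Y} (h : f = g) {U : Y.Opens} {V : X.Opens}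
    (hf : V ≤ f ⁻¹ᵁ U) (hg : V ≤ g ⁻¹ᵁ U) : f.appLE U V hf = g.appLE U V hg := by
  subst h
  rfl

theorem scalar_appLE {T T' : Over (Spec (.of K))} (g : T' ⟶ T) (U : T.left.Opens)
    (V : T'.left.Opens) (h : V ≤ g.left ⁻¹ᵁ U) (r : K) :
    (g.left.appLE U V h).hom (scalar T U r) = scalar T' V r := by
  have : T.hom.appLE ⊤ U le_top ≫ g.left.appLE U V h = T'.hom.appLE ⊤ V le_top := by
    refine (Scheme.Hom.appLE_comp_appLE g.left T.hom ⊤ U V le_top h).trans ?_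
    exact appLE_congr_hom (Over.w g) _ _
  exact DFunLike.congr_fun (congrArg CommRingCat.Hom.hom this) _

section Coord

variable {T T' : Over (Spec (.of K))} (t : T ⟶ projSpace K n) {U V : T.left.Opens} {a b : Fin n}

/-- The regular function `X_j / X_a` at a `T`-point of projective space, over an open which is
mapped into the standard open `X_a ≠ 0`. -/
def coord (h : U ≤ t.left ⁻¹ᵁ chart K n a) (j : Fin n) : Γ(T.left, U) :=
  (t.left.appLE (chart K n a) U h).hom (ratio K n a j)

theorem coord_self (h : U ≤ t.left ⁻¹ᵁ chart K n a) : coord t h a = 1 := by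
  rw [coord, ratio_self, map_one]

theorem coord_comp (g : T' ⟶ T) {W : T'.left.Opens} (hW : W ≤ g.left ⁻¹ᵁ U)
    (h : U ≤ t.left ⁻¹ᵁ chart K n a) (h' : W ≤ (g ≫ t).left ⁻¹ᵁ chart K n a) (j : Fin n) :
    coord (g ≫ t) h' j = (g.left.appLE U W hW).hom (coord t h j) := by
  have := Scheme.Hom.appLE_comp_appLE g.left t.left (chart K n a) U W h hW
  exact (DFunLike.congr_fun (congrArg CommRingCat.Hom.hom this) _).symm

theorem coord_res (h : U ≤ t.left ⁻¹ᵁ chart K n a) (hV : V ≤ U) (j : Fin n) :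
    T.left.presheaf.map (homOfLE hV).op (coord t h j) = coord t (hV.trans h) j := by
  have := Scheme.Hom.appLE_map t.left h (homOfLE hV).op
  exact DFunLike.congr_fun (congrArg CommRingCat.Hom.hom this) _

/-- The transition rule $(X_b/X_a)(X_j/X_b)=X_j/X_a$, to which every comparison between charts is
reduced. -/
theorem coord_mul (ha : U ≤ t.left ⁻¹ᵁ chart K n a) (hb : U ≤ t.left ⁻¹ᵁ chart K n b)
    (j : Fin n) : coord t ha b * coord t hb j = coord t ha j := by
  have hab : U ≤ t.left ⁻¹ᵁ (chart K n a ⊓ chart K n b) := le_inf ha hb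
  have h1 : ∀ z, (t.left.appLE (chart K n a) U ha).hom z = (t.left.appLE _ U hab).hom
      ((projSpace K n).left.presheaf.map (homOfLE inf_le_left).op z) := fun z =>
    (DFunLike.congr_fun (congrArg CommRingCat.Hom.hom
      (Scheme.Hom.map_appLE t.left hab (homOfLE inf_le_left).op)) z).symm
  have h2 : ∀ z, (t.left.appLE (chart K n b) U hb).hom z = (t.left.appLE _ U hab).hom
      ((projSpace K n).left.presheaf.map (homOfLE inf_le_right).op z) := fun z =>
    (DFunLike.congr_fun (congrArg CommRingCat.Hom.hom
      (Scheme.Hom.map_appLE t.left hab (homOfLE inf_le_right).op)) z).symm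
  rw [coord, coord, coord, h1, h1, h2, ← map_mul]
  exact congrArg _ (ratio_mul_ratio a b j _ _ _)

theorem basicOpen_coord (ha : U ≤ t.left ⁻¹ᵁ chart K n a) (b : Fin n) :
    T.left.basicOpen (coord t ha b) = U ⊓ t.left ⁻¹ᵁ chart K n b := by
  have h := Scheme.basicOpen_appLE t.left U (chart K n a) ha (ratio K n a b)
  rw [basicOpen_ratio] at h
  refine h.trans (le_antisymm (inf_le_inf_left _ fun x hx => hx.2) ?_)
  exact le_inf inf_le_left fun x hx => ⟨ha hx.1, hx.2⟩

theorem le_preimage_chart_of_isUnit (ha : U ≤ t.left ⁻¹ᵁ chart K n a)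
    (hb : IsUnit (coord t ha b)) : U ≤ t.left ⁻¹ᵁ chart K n b := by
  have h := basicOpen_coord t ha b
  rw [Scheme.basicOpen_of_isUnit _ hb] at h
  exact inf_eq_left.1 h.symm

theorem isUnit_coord (ha : U ≤ t.left ⁻¹ᵁ chart K n a) (hb : U ≤ t.left ⁻¹ᵁ chart K n b) :
    IsUnit (coord t ha b) :=
  IsUnit.of_mul_eq_one (coord t hb a) (by rw [coord_mul, coord_self])

theorem ι_comp_eq_of_coord_eq (t' : T ⟶ projSpace K n) (h : U ≤ t.left ⁻¹ᵁ chart K n a)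
    (h' : U ≤ t'.left ⁻¹ᵁ chart K n a) (hj : ∀ j, coord t h j = coord t' h' j) :
    U.ι ≫ t.left = U.ι ≫ t'.left := by
  rw [ι_comp_eq_of_isAffineOpen t.left (isAffineOpen_chart a) h,
    ι_comp_eq_of_isAffineOpen t'.left (isAffineOpen_chart a) h']
  congr 3
  refine chart_hom_ext a _ _ (fun r => ?_) hj
  rw [scalar_appLE, scalar_appLE]

theorem exists_chart_nhd (U : T.left.Opens) (x : T.left) (hx : x ∈ U) :
    ∃ (a : Fin n) (V : T.left.Opens), x ∈ V ∧ V ≤ U ∧ V ≤ t.left ⁻¹ᵁ chart K n a := by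
  obtain ⟨a, ha⟩ := exists_mem_chart (t.left x)
  exact ⟨a, U ⊓ t.left ⁻¹ᵁ chart K n a, ⟨hx, ha⟩, inf_le_left, inf_le_right⟩

end Coord

theorem scheme_hom_ext_of_nhds {X Y : Scheme.{u}} (f g : X ⟶ Y)
    (h : ∀ x : X, ∃ U : X.Opens, x ∈ U ∧ U.ι ≫ f = U.ι ≫ g) : f = g := by
  choose U hx hU using h
  have hc : TopologicalSpace.IsOpenCover U :=
    top_le_iff.1 fun x _ => TopologicalSpace.Opens.mem_iSup.2 ⟨x, hx x⟩
  exact (X.openCoverOfIsOpenCover U hc).hom_ext _ _ hU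

theorem hom_ext_of_coord {T : Over (Spec (.of K))} (t t' : T ⟶ projSpace K n)
    (h : ∀ x : T.left, ∃ (U : T.left.Opens) (a : Fin n) (ht : U ≤ t.left ⁻¹ᵁ chart K n a)
      (ht' : U ≤ t'.left ⁻¹ᵁ chart K n a), x ∈ U ∧ ∀ j, coord t ht j = coord t' ht' j) :
    t = t' := by
  ext1
  refine scheme_hom_ext_of_nhds _ _ fun x => ?_
  obtain ⟨U, a, ht, ht', hx, hj⟩ := h x
  exact ⟨U, hx, ι_comp_eq_of_coord_eq t t' ht ht' hj⟩

theorem section_eq_zero_of_nhds {X : Scheme.{u}} {U : X.Opens} (s : Γ(X, U))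
    (h : ∀ x ∈ U, ∃ (V : X.Opens) (hV : V ≤ U), x ∈ V ∧ X.presheaf.map (homOfLE hV).op s = 0) :
    s = 0 := by
  choose V hV hx h0 using h
  refine X.sheaf.eq_of_locally_eq' (fun x : U => V x.1 x.2) U (fun x => homOfLE (hV x.1 x.2))
    (fun x hxU => TopologicalSpace.Opens.mem_iSup.2 ⟨⟨x, hxU⟩, hx x hxU⟩) s 0 fun x => ?_
  rw [map_zero]
  exact h0 x.1 x.2

theorem hom_to_Spec_ext {X : Scheme.{u}} {R : CommRingCat.{u}} (f g : X ⟶ Spec R)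
    (h : f.appLE ⊤ ⊤ le_top = g.appLE ⊤ ⊤ le_top) : f = g := by
  refine scheme_hom_ext_of_nhds _ _ fun x => ⟨⊤, trivial, ?_⟩
  rw [ι_comp_eq_of_appLE, ι_comp_eq_of_appLE, h]

theorem exists_hom_of_coord (T : Over (Spec (.of K))) (a : Fin n) (x : Fin n → Γ(T.left, ⊤))
    (hx : x a = 1) : ∃ (t : T ⟶ projSpace K n) (h : ⊤ ≤ t.left ⁻¹ᵁ chart K n a),
      ∀ j, coord t h j = x j := by
  obtain ⟨ψ, h1, h2⟩ := exists_chart_hom (R := Γ(T.left, ⊤)) a (scalar T ⊤) x hx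
  let f : T.left ⟶ (projSpace K n).left := toAffineOpen (isAffineOpen_chart a) ψ
  have hf : ⊤ ≤ f ⁻¹ᵁ chart K n a := le_preimage_toAffineOpen _ _
  have hψ : f.appLE _ _ hf = ψ := toAffineOpen_appLE _ _ _
  have hw : f ≫ (projSpace K n).hom = T.hom := by
    apply hom_to_Spec_ext
    refine (Scheme.Hom.appLE_comp_appLE f (projSpace K n).hom ⊤ (chart K n a) ⊤ le_top hf).symm.trans
      ?_
    rw [hψ, ← cancel_epi (Scheme.ΓSpecIso (.of K)).inv]
    ext r
    exact h1 r
  refine ⟨Over.homMk f hw, hf, fun j => ?_⟩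
  rw [← h2, ← hψ]
  rfl

/-- An open of a scheme over `Spec K`. -/
abbrev openOver (T : Over (Spec (.of K))) (U : T.left.Opens) : Over (Spec (.of K)) :=
  Over.mk (U.ι ≫ T.hom)

/-- The inclusion of an open of a scheme over `Spec K`. -/
abbrev openOverι (T : Over (Spec (.of K))) (U : T.left.Opens) : openOver T U ⟶ T :=
  Over.homMk U.ι

theorem exists_hom_of_coord_on (T : Over (Spec (.of K))) (U : T.left.Opens) (a : Fin n)
    (x : Fin n → Γ(T.left, U)) (hx : x a = 1) :
    ∃ (t : openOver T U ⟶ projSpace K n) (h : ⊤ ≤ t.left ⁻¹ᵁ chart K n a),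
      ∀ j, coord t h j = (U.ι.appLE U ⊤ U.ι_preimage_self.ge).hom (x j) :=
  exists_hom_of_coord (openOver T U) a (fun j => (U.ι.appLE U ⊤ U.ι_preimage_self.ge).hom (x j))
    (by rw [hx, map_one])

end SkewProj

namespace SkewProj

variable {K : Type u} [Field K] {n : ℕ}

/-! ### Gluing points of projective space -/

/-- The case $j=a$ of the hypothesis exhibits an inverse of $X_b/X_a$ at `t`, so `t` lies in chart
$b$ as well; cancelling this unit identifies the coordinates there. -/
theorem eq_of_coord_mul {T : Over (Spec (.of K))} (t t' : T ⟶ projSpace K n) {a b : Fin n}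
    (ha : ⊤ ≤ t.left ⁻¹ᵁ chart K n a) (hb : ⊤ ≤ t'.left ⁻¹ᵁ chart K n b)
    (h : ∀ j, coord t ha b * coord t' hb j = coord t ha j) : t = t' := by
  have hu : IsUnit (coord t ha b) :=
    IsUnit.of_mul_eq_one _ ((h a).trans (coord_self t ha))
  have hb' := le_preimage_chart_of_isUnit t ha hu
  refine hom_ext_of_coord t t' fun x => ⟨⊤, b, hb', hb, trivial, fun j => hu.mul_left_cancel ?_⟩
  rw [h, coord_mul]

/-- Agreement on overlaps, stated for any `T'` lying over both pieces so that it applies to the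
fibre products required for gluing. The two composites to `T` coincide and land in `U ⊓ V`, where
the cocycle condition is available. -/
theorem comp_eq_of_coord_mul {T T' A B : Over (Spec (.of K))} {α : A ⟶ T} {β : B ⟶ T}
    {U V : T.left.Opens} (hα : ⊤ ≤ α.left ⁻¹ᵁ U) (hβ : ⊤ ≤ β.left ⁻¹ᵁ V)
    {y : Fin n → Γ(T.left, U)} {z : Fin n → Γ(T.left, V)} {a b : Fin n}
    {t : A ⟶ projSpace K n} {t' : B ⟶ projSpace K n}
    (ha : ⊤ ≤ t.left ⁻¹ᵁ chart K n a) (hb : ⊤ ≤ t'.left ⁻¹ᵁ chart K n b)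
    (hy : ∀ j, coord t ha j = (α.left.appLE U ⊤ hα).hom (y j))
    (hz : ∀ j, coord t' hb j = (β.left.appLE V ⊤ hβ).hom (z j))
    (hmul : ∀ j, T.left.presheaf.map (homOfLE (inf_le_left : U ⊓ V ≤ U)).op (y b) *
      T.left.presheaf.map (homOfLE (inf_le_right : U ⊓ V ≤ V)).op (z j) =
      T.left.presheaf.map (homOfLE (inf_le_left : U ⊓ V ≤ U)).op (y j))
    (g₁ : T' ⟶ A) (g₂ : T' ⟶ B) (hg : g₁ ≫ α = g₂ ≫ β) : g₁ ≫ t = g₂ ≫ t' := by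
  let q := g₁ ≫ α
  have hqa : ⊤ ≤ q.left ⁻¹ᵁ U := fun x _ => hα (x := g₁.left x) trivial
  have hqb' : ⊤ ≤ (g₂ ≫ β).left ⁻¹ᵁ V := fun x _ => hβ (x := g₂.left x) trivial
  have hqb : ⊤ ≤ q.left ⁻¹ᵁ V := by
    rw [show q = g₂ ≫ β from hg]
    exact hqb'
  have hqab : ⊤ ≤ q.left ⁻¹ᵁ (U ⊓ V) := le_inf hqa hqb
  have ha' : ⊤ ≤ (g₁ ≫ t).left ⁻¹ᵁ chart K n a := fun x _ => ha (x := g₁.left x) trivial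
  have hb' : ⊤ ≤ (g₂ ≫ t').left ⁻¹ᵁ chart K n b := fun x _ => hb (x := g₂.left x) trivial
  have h₁ : ∀ j, coord (g₁ ≫ t) ha' j = (q.left.appLE U ⊤ hqa).hom (y j) := by
    intro j
    refine (coord_comp t g₁ le_top ha _ j).trans ?_
    rw [hy]
    exact DFunLike.congr_fun (congrArg CommRingCat.Hom.hom
      (Scheme.Hom.appLE_comp_appLE g₁.left α.left U ⊤ ⊤ hα le_top)) _
  have h₂ : ∀ j, coord (g₂ ≫ t') hb' j = (q.left.appLE V ⊤ hqb).hom (z j) := by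
    intro j
    refine (coord_comp t' g₂ le_top hb _ j).trans ?_
    rw [hz, appLE_congr_hom (congrArg (fun f => f.left) hg : q.left = _) hqb hqb']
    exact DFunLike.congr_fun (congrArg CommRingCat.Hom.hom
      (Scheme.Hom.appLE_comp_appLE g₂.left β.left V ⊤ ⊤ hβ le_top)) _
  have hr₁ : ∀ j, (q.left.appLE U ⊤ hqa).hom (y j) = (q.left.appLE _ ⊤ hqab).hom
      (T.left.presheaf.map (homOfLE inf_le_left).op (y j)) := fun j =>
    (DFunLike.congr_fun (congrArg CommRingCat.Hom.hom
      (Scheme.Hom.map_appLE q.left hqab (homOfLE inf_le_left).op)) _).symm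
  have hr₂ : ∀ j, (q.left.appLE V ⊤ hqb).hom (z j) = (q.left.appLE _ ⊤ hqab).hom
      (T.left.presheaf.map (homOfLE inf_le_right).op (z j)) := fun j =>
    (DFunLike.congr_fun (congrArg CommRingCat.Hom.hom
      (Scheme.Hom.map_appLE q.left hqab (homOfLE inf_le_right).op)) _).symm
  refine eq_of_coord_mul (g₁ ≫ t) (g₂ ≫ t') ha' hb' fun j => ?_
  rw [h₁, h₁, h₂, hr₁, hr₁, hr₂, ← map_mul]
  exact congrArg _ (hmul j)

theorem exists_hom_of_cover (T : Over (Spec (.of K))) (U : Fin n → T.left.Opens)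
    (hU : ∀ x, ∃ a, x ∈ U a) (y : ∀ a, Fin n → Γ(T.left, U a)) (hy : ∀ a, y a a = 1)
    (hmul : ∀ (a b j : Fin n) (V : T.left.Opens) (ha : V ≤ U a) (hb : V ≤ U b),
      T.left.presheaf.map (homOfLE ha).op (y a b) * T.left.presheaf.map (homOfLE hb).op (y b j) =
        T.left.presheaf.map (homOfLE ha).op (y a j)) :
    ∃ t : T ⟶ projSpace K n, ∀ a, ∃ h : U a ≤ t.left ⁻¹ᵁ chart K n a, ∀ j, coord t h j = y a j := by
  choose t ht htc using fun a => exists_hom_of_coord_on T (U a) a (y a) (hy a)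
  have hc : TopologicalSpace.IsOpenCover U :=
    top_le_iff.1 fun x _ => TopologicalSpace.Opens.mem_iSup.2 (hU x)
  let 𝒰 := T.left.openCoverOfIsOpenCover U hc
  have hglue : ∀ a b : Fin n, pullback.fst (U a).ι (U b).ι ≫ (t a).left =
      pullback.snd (U a).ι (U b).ι ≫ (t b).left := by
    intro a b
    let T' : Over (Spec (.of K)) := Over.mk (pullback.fst (U a).ι (U b).ι ≫ (U a).ι ≫ T.hom)
    let g₁ : T' ⟶ openOver T (U a) := Over.homMk (pullback.fst (U a).ι (U b).ι)
    let g₂ : T' ⟶ openOver T (U b) := Over.homMk (pullback.snd (U a).ι (U b).ι)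
      (pullback.condition_assoc _).symm
    have hg : g₁ ≫ openOverι T (U a) = g₂ ≫ openOverι T (U b) := by
      ext1
      exact pullback.condition
    have := comp_eq_of_coord_mul (T := T) (T' := T') (α := openOverι T (U a))
      (β := openOverι T (U b)) (U a).ι_preimage_self.ge
      (U b).ι_preimage_self.ge (y := y a) (z := y b) (ht a) (ht b)
      (htc a) (htc b) (fun j => hmul a b j _ _ _) g₁ g₂ hg
    exact congrArg (fun f => f.left) this
  let f : T.left ⟶ (projSpace K n).left := 𝒰.glueMorphisms (fun a => (t a).left) hglue
  have hf : ∀ a, (U a).ι ≫ f = (t a).left := fun a => 𝒰.ι_glueMorphisms _ hglue a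
  have hw : f ≫ (projSpace K n).hom = T.hom := by
    refine 𝒰.hom_ext _ _ fun a => ?_
    exact (Category.assoc _ _ _).symm.trans
      ((congrArg (· ≫ (projSpace K n).hom) (hf a)).trans (Over.w (t a)))
  refine ⟨Over.homMk f hw, fun a => ?_⟩
  have ha : U a ≤ f ⁻¹ᵁ chart K n a := by
    intro x hx
    have := ht a (x := ⟨x, hx⟩) trivial
    rw [← hf] at this
    exact this
  refine ⟨ha, fun j => ?_⟩
  have hta : openOverι T (U a) ≫ Over.homMk f hw = t a := by
    ext1
    exact hf a
  have h := coord_comp (Over.homMk f hw : T ⟶ projSpace K n) (openOverι T (U a)) (W := ⊤)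
    (U := U a) (U a).ι_preimage_self.ge ha (hta ▸ ht a) j
  have h' : coord (openOverι T (U a) ≫ Over.homMk f hw) (hta ▸ ht a) j = coord (t a) (ht a) j := by
    congr 1
  rw [h', htc] at h
  -- Sections over `U a` are the global sections of the open subscheme, so the known equality of
  -- coordinates there descends to `T`.
  have hinj : Function.Injective ((U a).ι.appLE (U a) ⊤ (U a).ι_preimage_self.ge).hom := by
    have : IsIso ((U a).ι.appLE (U a) ⊤ (U a).ι_preimage_self.ge) := by
      rw [Scheme.Opens.ι_appLE]
      have e : (U a).ι ''ᵁ ⊤ = U a := by simp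
      have : IsIso (homOfLE e.le) :=
        ⟨homOfLE e.ge, Subsingleton.elim _ _, Subsingleton.elim _ _⟩
      exact (inferInstance : IsIso (T.left.presheaf.map (homOfLE e.le).op))
    exact (ConcreteCategory.bijective_of_isIso _).1
  exact (hinj h).symm

end SkewProj

namespace SkewProj

variable {K : Type u} [Field K] {n : ℕ}

/-! ### The relations of `S_ω` on pairs of points -/

theorem scalar_res {T : Over (Spec (.of K))} {U V : T.left.Opens} (h : V ≤ U) (r : K) :
    T.left.presheaf.map (homOfLE h).op (scalar T U r) = scalar T V r :=
  DFunLike.congr_fun (congrArg CommRingCat.Hom.hom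
    (Scheme.Hom.appLE_map T.hom (le_top : U ≤ T.hom ⁻¹ᵁ ⊤) (homOfLE h).op)) _

/-- The bilinear forms `X_j X_i - ω_{ij} X_i X_j` vanish on a pair of points. -/
def Related (ω : Fin n → Fin n → K) {T : Over (Spec (.of K))} (t t' : T ⟶ projSpace K n) : Prop :=
  ∀ (U : T.left.Opens) (a b : Fin n) (h : U ≤ t.left ⁻¹ᵁ chart K n a)
    (h' : U ≤ t'.left ⁻¹ᵁ chart K n b) (i j : Fin n),
    coord t h j * coord t' h' i = scalar T U (ω i j) * (coord t h i * coord t' h' j)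

/-- The cubic forms `X_i X_j X_k` for the triples with `q_{(ijk)} ≠ 1` vanish on a point. -/
def CubicsVanish (ω : Fin n → Fin n → K) {T : Over (Spec (.of K))} (t : T ⟶ projSpace K n) :
    Prop :=
  ∀ (U : T.left.Opens) (a : Fin n) (h : U ≤ t.left ⁻¹ᵁ chart K n a) (i j k : Fin n),
    qNumber ω i j k ≠ 1 → coord t h i * coord t h j * coord t h k = 0

section

variable {ω : Fin n → Fin n → K} (hω : ∀ i j, ω i j * ω j i = 1) (hdiag : ∀ i, ω i i = 1)
  {T T' : Over (Spec (.of K))} {t t' : T ⟶ projSpace K n}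

theorem Related.comp (h : Related ω t t') (g : T' ⟶ T) : Related ω (g ≫ t) (g ≫ t') := by
  intro U a b ha hb i j
  have ha' : (g ≫ t).left ⁻¹ᵁ chart K n a = g.left ⁻¹ᵁ (t.left ⁻¹ᵁ chart K n a) := rfl
  have hb' : (g ≫ t').left ⁻¹ᵁ chart K n b = g.left ⁻¹ᵁ (t'.left ⁻¹ᵁ chart K n b) := rfl
  have hW : U ≤ g.left ⁻¹ᵁ (t.left ⁻¹ᵁ chart K n a ⊓ t'.left ⁻¹ᵁ chart K n b) :=
    le_inf (ha.trans ha'.le) (hb.trans hb'.le)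
  rw [coord_comp t g hW inf_le_left, coord_comp t' g hW inf_le_right,
    coord_comp t g hW inf_le_left, coord_comp t' g hW inf_le_right,
    ← scalar_appLE g _ _ hW, ← map_mul, ← map_mul, ← map_mul, h]

theorem CubicsVanish.comp (h : CubicsVanish ω t) (g : T' ⟶ T) : CubicsVanish ω (g ≫ t) := by
  intro U a ha i j k hq
  have hW : U ≤ g.left ⁻¹ᵁ (t.left ⁻¹ᵁ chart K n a) := ha
  rw [coord_comp t g hW le_rfl, coord_comp t g hW le_rfl, coord_comp t g hW le_rfl,
    ← map_mul, ← map_mul, h _ _ _ _ _ _ hq, map_zero]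

include hω in
-- Since $\omega_{ij}\omega_{ji}=1$, reading a pair backwards gives the same problem for the
-- transposed matrix. Facts about the first point thereby transfer to the second.
theorem Related.symm (h : Related ω t t') : Related (fun i j => ω j i) t' t := by
  intro U a b ha hb i j
  have h1 := h U b a hb ha i j
  have h2 := congrArg (scalar T U) (hω i j)
  rw [map_mul, map_one] at h2
  linear_combination (-scalar T U (ω j i)) * h1 - coord t hb i * coord t' ha j * h2

/-- If locally `t'` lies in chart $b$, the relation for $(b,a)$ reads $1=\omega_{ba}x_bx'_a$, so
$x'_a$ is a unit and `t'` lies in chart $a$ too. -/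
theorem Related.le_preimage (h : Related ω t t') {U : T.left.Opens} {a : Fin n}
    (ha : U ≤ t.left ⁻¹ᵁ chart K n a) : U ≤ t'.left ⁻¹ᵁ chart K n a := by
  intro x hx
  obtain ⟨b, V, hxV, hVU, hb⟩ := exists_chart_nhd t' U x hx
  refine le_preimage_chart_of_isUnit t' hb (b := a) ?_ hxV
  have h1 := h V a b (hVU.trans ha) hb b a
  rw [coord_self, coord_self, one_mul] at h1
  refine IsUnit.of_mul_eq_one (scalar T V (ω b a) * coord t (hVU.trans ha) b) ?_
  rw [h1]
  ring

theorem Related.coord_eq (h : Related ω t t') {U : T.left.Opens} {a : Fin n}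
    (ha : U ≤ t.left ⁻¹ᵁ chart K n a) (ha' : U ≤ t'.left ⁻¹ᵁ chart K n a) (i : Fin n) :
    coord t' ha' i = scalar T U (ω i a) * coord t ha i := by
  simpa [coord_self] using h U a a ha ha' i a

include hω in
-- Inserting $x'_i=\omega_{ia}x_i$ into the relation for $(i,j)$ gives
-- $(\omega_{ia}-\omega_{ij}\omega_{ja})x_ix_j=0$; the scalar is nonzero when $q_{(ija)}\ne1$.
theorem Related.mul_eq_zero (h : Related ω t t') {U : T.left.Opens} {i j a : Fin n}
    (ha : U ≤ t.left ⁻¹ᵁ chart K n a) (hq : qNumber ω i j a ≠ 1) :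
    coord t ha i * coord t ha j = 0 := by
  have ha' := h.le_preimage ha
  have h1 := h U a a ha ha' i j
  rw [h.coord_eq ha, h.coord_eq ha] at h1
  have h2 : scalar T U (ω i a - ω i j * ω j a) * (coord t ha i * coord t ha j) = 0 := by
    rw [map_sub, map_mul]
    linear_combination h1
  have h3 : ω i a - ω i j * ω j a ≠ 0 := by
    intro h0
    refine hq ?_
    rw [qNumber, ← sub_eq_zero.1 h0, hω]
  exact (((Ne.isUnit h3).map (scalar T U)).mul_right_eq_zero).1 h2

include hω in
-- Because $q_{(ijk)}=q_{(ija)}q_{(jka)}q_{(kia)}$, a nontrivial $q_{(ijk)}$ forces one of the three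
-- factors to be nontrivial, and then the corresponding product of two coordinates already vanishes.
theorem Related.cubicsVanish (h : Related ω t t') : CubicsVanish ω t := by
  intro U a ha i j k hq
  by_cases h1 : qNumber ω i j a = 1
  · by_cases h2 : qNumber ω j k a = 1
    · have h3 : qNumber ω k i a ≠ 1 := by
        intro h3
        refine hq ?_
        have : qNumber ω i j k = qNumber ω i j a * qNumber ω j k a * qNumber ω k i a := by
          simp only [qNumber]
          linear_combination (-(ω i j * ω j k * ω k i)) *
            ((ω k a * ω a k * (ω i a * ω a i)) * hω j a + ω k a * ω a k * hω i a + hω k a)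
        rw [this, h1, h2, h3]
        ring
      rw [mul_right_comm, mul_comm (coord t ha i), h.mul_eq_zero hω ha h3, zero_mul]
    · rw [mul_assoc, h.mul_eq_zero hω ha h2, mul_zero]
  · rw [h.mul_eq_zero hω ha h1, zero_mul]

include hω in
-- Transposing $\omega$ inverts every $q_{(ijk)}$, so the reversed pair yields the same set of
-- cubics.
theorem Related.cubicsVanish_right (h : Related ω t t') : CubicsVanish ω t' := by
  intro U a ha i j k hq
  refine (h.symm hω).cubicsVanish (fun i j => hω j i) U a ha i j k fun h1 => hq ?_
  have h2 : qNumber ω i j k * qNumber (fun i j => ω j i) i j k = 1 := by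
    simp only [qNumber]
    linear_combination (ω j k * ω k j * (ω k i * ω i k)) * hω i j + ω k i * ω i k * hω j k + hω k i
  rwa [h1, mul_one] at h2

theorem Related.right_unique {t'' : T ⟶ projSpace K n} (h : Related ω t t')
    (h' : Related ω t t'') : t' = t'' := by
  refine hom_ext_of_coord _ _ fun x => ?_
  obtain ⟨a, V, hxV, -, ha⟩ := exists_chart_nhd t ⊤ x trivial
  refine ⟨V, a, h.le_preimage ha, h'.le_preimage ha, hxV, fun j => ?_⟩
  rw [h.coord_eq ha, h'.coord_eq ha]

/-- Either $q_{(ija)}=1$ and the scalars agree, or the cubic $x_ix_jx_a$ with $x_a=1$ kills the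
product. This is the compatibility needed to glue the successor. -/
theorem scalar_mul_coord_mul_coord {ω : Fin n → Fin n → K} (hω : ∀ i j, ω i j * ω j i = 1)
    (ht : CubicsVanish ω t) {U : T.left.Opens} {a : Fin n}
    (ha : U ≤ t.left ⁻¹ᵁ chart K n a) (i j : Fin n) :
    scalar T U (ω i j * ω j a) * (coord t ha i * coord t ha j) =
      scalar T U (ω i a) * (coord t ha i * coord t ha j) := by
  by_cases hq : qNumber ω i j a = 1
  · have : ω i j * ω j a = ω i a := by
      rw [qNumber] at hq
      linear_combination ω i a * hq - ω i j * ω j a * hω i a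
    rw [this]
  · have := ht U a ha i j a hq
    rw [coord_self, mul_one] at this
    rw [this, mul_zero, mul_zero]

include hω hdiag in
-- The successor is prescribed on chart $a$ by the forced formula $x'_j=\omega_{ja}x_j$; the cubics
-- are exactly what makes these prescriptions agree on overlaps.
theorem CubicsVanish.exists_related (ht : CubicsVanish ω t) :
    ∃ t' : T ⟶ projSpace K n, Related ω t t' := by
  obtain ⟨t', ht'⟩ := exists_hom_of_cover T (fun a => t.left ⁻¹ᵁ chart K n a)
    (fun x => exists_mem_chart (t.left x))
    (fun a j => scalar T _ (ω j a) * coord t (le_refl (t.left ⁻¹ᵁ chart K n a)) j)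
    (fun a => by rw [coord_self, hdiag, map_one, mul_one])
    (fun a b j V ha hb => by
      rw [map_mul, map_mul, map_mul, scalar_res, scalar_res, scalar_res, coord_res, coord_res,
        coord_res]
      -- The scalars can be compared only against $x_jx_b$, hence the extra factor $x_b$, a unit on
      -- the overlap.
      refine (isUnit_coord t ha hb).mul_left_cancel ?_
      have h1 := scalar_mul_coord_mul_coord hω ht ha j b
      have h2 := coord_mul t ha hb j
      rw [map_mul] at h1
      rw [← h2] at h1 ⊢
      linear_combination h1)
  refine ⟨t', fun U a b ha hb i j => ?_⟩
  obtain ⟨hU, hc⟩ := ht' a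
  have ha' : U ≤ t'.left ⁻¹ᵁ chart K n a := ha.trans hU
  have hc' : ∀ j, coord t' ha' j = scalar T U (ω j a) * coord t ha j := by
    intro j
    rw [← coord_res t' hU ha, hc, map_mul, scalar_res, coord_res]
  rw [← coord_mul t' hb ha', ← coord_mul t' hb ha' j, hc', hc']
  have h1 := scalar_mul_coord_mul_coord hω ht ha i j
  rw [map_mul] at h1
  linear_combination (-coord t' hb a) * h1

end

end SkewProj

namespace SkewProj

/-! ### Multilinear forms on sequences of points -/

section PathAction

variable {K R : Type*} [Field K] [CommRing R] [Algebra K R] {n : ℕ} (c : ℕ → Fin n → R)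

/-- The free algebra acts on sequences: `X_j` shifts a sequence and multiplies it by `c_k(j)`. -/
def pathAction : FreeAlgebra K (Fin n) →ₐ[K] Module.End R (ℕ → R) :=
  FreeAlgebra.lift K fun j =>
    { toFun := fun φ k => c k j * φ (k + 1)
      map_add' := fun φ ψ => by ext k; simp [mul_add]
      map_smul' := fun r φ => by ext k; simp [mul_left_comm] }

theorem pathAction_ι (j : Fin n) (φ : ℕ → R) (k : ℕ) :
    pathAction (K := K) c (FreeAlgebra.ι K j) φ k = c k j * φ (k + 1) := by
  simp [pathAction]

/-- The word `X_{w 1} ⋯ X_{w i}`. -/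
def word (K : Type*) [Field K] {n i : ℕ} (w : Fin i → Fin n) : FreeAlgebra K (Fin n) :=
  (List.ofFn fun k => FreeAlgebra.ι K (w k)).prod

theorem word_succ {i : ℕ} (w : Fin (i + 1) → Fin n) :
    word K w = FreeAlgebra.ι K (w 0) * word K fun k : Fin i => w k.succ := by
  simp [word, List.ofFn_succ]

theorem pathAction_word {i : ℕ} (w : Fin i → Fin n) (φ : ℕ → R) (k : ℕ) :
    pathAction c (word K w) φ k = (∏ m : Fin i, c (k + m) (w m)) * φ (k + i) := by
  induction i generalizing k with
  | zero => simp [word]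
  | succ i ih =>
    rw [word_succ, map_mul, Module.End.mul_apply, pathAction_ι, ih, Fin.prod_univ_succ]
    simp only [Fin.val_zero, add_zero, Fin.val_succ, add_right_comm k 1, mul_assoc]
    simp only [add_assoc]

theorem wordCoeff_word {i m : ℕ} (v : Fin m → Fin n) (w : Fin i → Fin n) :
    wordCoeff (word K v) w = if List.ofFn v = List.ofFn w then 1 else 0 := by
  have h1 : FreeAlgebra.equivMonoidAlgebraFreeMonoid (word K v) =
      MonoidAlgebra.of K _ (FreeMonoid.ofList (List.ofFn v)) := by
    induction m with
    | zero => simp [word]; rfl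
    | succ m ih =>
      rw [word_succ, map_mul, ih, List.ofFn_succ, FreeMonoid.ofList_cons, map_mul]
      simp [FreeAlgebra.equivMonoidAlgebraFreeMonoid]
  rw [wordCoeff, h1, MonoidAlgebra.of_apply, MonoidAlgebra.coeff_single]
  split_ifs with h
  · rw [h, Finsupp.single_eq_same]
  · exact Finsupp.single_eq_of_ne fun h' => h (FreeMonoid.ofList.injective h').symm

theorem word_mem_degreePart {i : ℕ} (w : Fin i → Fin n) : word K w ∈ degreePart (K := K) i := by
  induction i with
  | zero => simp [word, degreePart]
  | succ i ih =>
    rw [word_succ, degreePart, pow_succ']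
    exact Submodule.mul_mem_mul (Submodule.subset_span ⟨_, rfl⟩) (ih _)

theorem span_word : Submodule.span K {f : FreeAlgebra K (Fin n) | ∃ (m : ℕ) (v : Fin m → Fin n),
    f = word K v} = ⊤ := by
  refine top_le_iff.1 fun f _ => ?_
  rw [← FreeAlgebra.equivMonoidAlgebraFreeMonoid.symm_apply_apply f]
  induction FreeAlgebra.equivMonoidAlgebraFreeMonoid f using MonoidAlgebra.induction_linear with
  | zero => simp
  | add x y hx hy => rw [map_add]; exact add_mem hx hy
  | single l r =>
    have h : FreeAlgebra.equivMonoidAlgebraFreeMonoid.symm (MonoidAlgebra.single l r) =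
        r • word K (fun k => (FreeMonoid.toList l).get k) := by
      have : (List.ofFn fun k => FreeAlgebra.ι K ((FreeMonoid.toList l).get k)) =
          (FreeMonoid.toList l).map (FreeAlgebra.ι K) := by
        conv_rhs => rw [← List.ofFn_get (FreeMonoid.toList l), List.map_ofFn]
        rfl
      rw [word, this]
      simp [FreeAlgebra.equivMonoidAlgebraFreeMonoid, FreeMonoid.lift_apply]
    rw [h]
    exact Submodule.smul_mem _ _ (Submodule.subset_span ⟨_, _, rfl⟩)

theorem wordCoeff_add {i : ℕ} (w : Fin i → Fin n) (f g : FreeAlgebra K (Fin n)) :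
    wordCoeff (f + g) w = wordCoeff f w + wordCoeff g w := by
  simp [wordCoeff]

theorem wordCoeff_smul {i : ℕ} (w : Fin i → Fin n) (r : K) (f : FreeAlgebra K (Fin n)) :
    wordCoeff (r • f) w = r * wordCoeff f w := by
  simp [wordCoeff]

/-- A word of length $m$ maps $\delta_i$ to a sequence whose value at $0$ is its coordinate product
times $\delta_i(m)$, so only words of length $i$ survive. Evaluation of multilinear forms becomes a
matrix coefficient of an algebra representation. -/
theorem sum_wordCoeff_eq_pathAction (i : ℕ) (f : FreeAlgebra K (Fin n)) :
    ∑ w : Fin i → Fin n, algebraMap K R (wordCoeff f w) * ∏ k : Fin i, c k (w k) =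
      pathAction c f (Pi.single i 1) 0 := by
  have hf : f ∈ Submodule.span K {f : FreeAlgebra K (Fin n) | ∃ (m : ℕ) (v : Fin m → Fin n),
    f = word K v} := by rw [span_word]; trivial
  induction hf using Submodule.span_induction with
  | mem f hf =>
    obtain ⟨m, v, rfl⟩ := hf
    rw [pathAction_word]
    simp only [wordCoeff_word, zero_add]
    by_cases hm : m = i
    · subst hm
      simp only [List.ofFn_injective.eq_iff]
      simp [apply_ite (algebraMap K R), ite_mul]
    · rw [Pi.single_eq_of_ne hm, mul_zero]
      refine Finset.sum_eq_zero fun w _ => ?_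
      rw [if_neg, map_zero, zero_mul]
      intro h
      exact hm (by simpa using congrArg List.length h)
  | zero => simp [wordCoeff]
  | add f g _ _ hf hg =>
    simp only [wordCoeff_add, map_add, add_mul, Finset.sum_add_distrib, hf, hg]
    simp
  | smul r f _ hf =>
    simp only [wordCoeff_smul, map_mul, mul_assoc, ← Finset.mul_sum, hf]
    simp [Algebra.smul_def]

/-- The kernel of a representation is a two-sided ideal, so only the quadratic generators need
checking. -/
theorem pathAction_eq_zero {ω : Fin n → Fin n → K}
    (hc : ∀ k i j, c k j * c (k + 1) i = algebraMap K R (ω i j) * (c k i * c (k + 1) j))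
    {f : FreeAlgebra K (Fin n)} (hf : f ∈ skewIdeal ω) : pathAction c f = 0 := by
  have h : skewIdeal ω ≤ TwoSidedIdeal.ker (pathAction (K := K) c) := by
    rw [skewIdeal, TwoSidedIdeal.span_le]
    rintro _ ⟨i, j, rfl⟩
    refine (TwoSidedIdeal.mem_ker _).2 ?_
    ext1 φ
    ext1 k
    simp only [map_sub, map_mul, map_smul, LinearMap.sub_apply, LinearMap.smul_apply,
      Module.End.mul_apply, Pi.sub_apply, Pi.smul_apply, pathAction_ι, LinearMap.zero_apply,
      Pi.zero_apply]
    rw [Algebra.smul_def]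
    linear_combination φ (k + 1 + 1) * hc k i j
  exact (TwoSidedIdeal.mem_ker _).1 (h hf)

end PathAction

end SkewProj

/-! ### Vanishing on tuples versus relations between consecutive points -/

namespace SkewProj

variable {K : Type u} [Field K] {n : ℕ}

section

variable {T T' : Over (Spec (.of K))} {i : ℕ} (t : Fin i → (T ⟶ projSpace K n))
  {U : T.left.Opens} {a : Fin i → Fin n}

/-- The coordinates of a finite sequence of points, extended by zero. -/
def coordSeq (h : ∀ k, U ≤ (t k).left ⁻¹ᵁ chart K n (a k)) (k : ℕ) (j : Fin n) : Γ(T.left, U) :=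
  if hk : k < i then coord (t ⟨k, hk⟩) (h ⟨k, hk⟩) j else 0

theorem coordSeq_coe (h : ∀ k, U ≤ (t k).left ⁻¹ᵁ chart K n (a k)) (k : Fin i) (j : Fin n) :
    coordSeq t h k j = coord (t k) (h k) j :=
  dif_pos k.2

theorem evalForm_eq_pathAction (f : FreeAlgebra K (Fin n))
    (h : ∀ k, U ≤ (t k).left ⁻¹ᵁ chart K n (a k)) :
    letI := (scalar T U).toAlgebra
    evalForm t f U a h = pathAction (coordSeq t h) f (Pi.single i 1) 0 := by
  let _ := (scalar T U).toAlgebra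
  rw [← sum_wordCoeff_eq_pathAction]
  simp only [coordSeq_coe]
  rfl

variable {t} {ω : Fin n → Fin n → K}

theorem vanishes_of_related
    (ht : ∀ (k : ℕ) (hk : k + 1 < i), Related ω (t ⟨k, k.lt_succ_self.trans hk⟩) (t ⟨k + 1, hk⟩)) :
    Vanishes (skewIdeal ω) t := by
  intro f hf _ U a h
  let _ := (scalar T U).toAlgebra
  rw [evalForm_eq_pathAction, pathAction_eq_zero _ _ hf]
  · rfl
  · intro k i' j
    by_cases hk : k + 1 < i
    · simp only [coordSeq, dif_pos hk, dif_pos (k.lt_succ_self.trans hk)]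
      exact ht k hk U _ _ _ _ i' j
    -- Past the end of the tuple the coordinates are zero, so both sides of the relation vanish.
    · simp [coordSeq, hk]

/-- The relations are bihomogeneous: a change of charts multiplies both sides by the same factor, so
one pair of charts near each point suffices. -/
theorem related_of_nhds {t t' : T ⟶ projSpace K n}
    (h : ∀ x : T.left, ∃ (U : T.left.Opens) (a b : Fin n) (ha : U ≤ t.left ⁻¹ᵁ chart K n a)
      (hb : U ≤ t'.left ⁻¹ᵁ chart K n b), x ∈ U ∧ ∀ i j,
      coord t ha j * coord t' hb i = scalar T U (ω i j) * (coord t ha i * coord t' hb j)) :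
    Related ω t t' := by
  intro U a b ha hb i j
  rw [← sub_eq_zero]
  refine section_eq_zero_of_nhds _ fun x hx => ?_
  obtain ⟨V, a', b', ha', hb', hxV, h⟩ := h x
  have hU : U ⊓ V ≤ U := inf_le_left
  have hV : U ⊓ V ≤ V := inf_le_right
  refine ⟨U ⊓ V, hU, ⟨hx, hxV⟩, ?_⟩
  have h1 := congrArg (T.left.presheaf.map (homOfLE hV).op) (h i j)
  simp only [map_mul, map_sub, coord_res, scalar_res] at h1 ⊢
  rw [← coord_mul t (hU.trans ha) (hV.trans ha'), ← coord_mul t (hU.trans ha) (hV.trans ha') i,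
    ← coord_mul t' (hU.trans hb) (hV.trans hb'), ← coord_mul t' (hU.trans hb) (hV.trans hb') j]
  linear_combination (coord t (hU.trans ha) a' * coord t' (hU.trans hb) b') * h1

theorem exists_common_nhd (t : Fin i → (T ⟶ projSpace K n)) (x : T.left) :
    ∃ (U : T.left.Opens) (a : Fin i → Fin n), x ∈ U ∧ ∀ k, U ≤ (t k).left ⁻¹ᵁ chart K n (a k) := by
  choose a ha using fun k => exists_mem_chart ((t k).left x)
  refine ⟨⟨⋂ k, ((t k).left ⁻¹ᵁ chart K n (a k) : Set T.left),
    isOpen_iInter_of_finite fun k => ((t k).left ⁻¹ᵁ chart K n (a k)).2⟩, a,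
    Set.mem_iInter.2 ha, fun k => Set.iInter_subset _ k⟩

/-- The generator, placed in positions $k,k+1$, is padded to degree $i$ by words whose letters are
the chart indices of the other points. Those coordinates equal $1$, so the padded form evaluates to
the bilinear relation itself. -/
theorem Vanishes.related (hv : Vanishes (skewIdeal ω) t) (k : ℕ) (hk : k + 1 < i) :
    Related ω (t ⟨k, k.lt_succ_self.trans hk⟩) (t ⟨k + 1, hk⟩) := by
  refine related_of_nhds fun x => ?_
  obtain ⟨U, a, hx, h⟩ := exists_common_nhd t x
  refine ⟨U, _, _, h _, h _, hx, fun i' j => ?_⟩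
  let _ := (scalar T U).toAlgebra
  obtain ⟨r, rfl⟩ := Nat.exists_eq_add_of_le (show k + 2 ≤ i from hk)
  let u : FreeAlgebra K (Fin n) := word K fun m : Fin k => a ⟨m, by omega⟩
  let v : FreeAlgebra K (Fin n) := word K fun m : Fin r => a ⟨k + 2 + m, by omega⟩
  let ρ : FreeAlgebra K (Fin n) := FreeAlgebra.ι K j * FreeAlgebra.ι K i' -
    ω i' j • (FreeAlgebra.ι K i' * FreeAlgebra.ι K j)
  have hρ : ρ ∈ degreePart (K := K) 2 := by
    have h2 : ∀ p q : Fin n, FreeAlgebra.ι K p * FreeAlgebra.ι K q ∈ degreePart (K := K) 2 := by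
      intro p q
      rw [degreePart, pow_two]
      exact Submodule.mul_mem_mul (Submodule.subset_span ⟨_, rfl⟩) (Submodule.subset_span ⟨_, rfl⟩)
    exact sub_mem (h2 _ _) (Submodule.smul_mem _ _ (h2 _ _))
  have hI : u * ρ * v ∈ skewIdeal ω :=
    TwoSidedIdeal.mul_mem_right _ _ _ (TwoSidedIdeal.mul_mem_left _ _ _
      (TwoSidedIdeal.subset_span ⟨i', j, rfl⟩))
  have hd : u * ρ * v ∈ degreePart (K := K) (k + 2 + r) := by
    rw [degreePart, pow_add, pow_add]
    exact Submodule.mul_mem_mul (Submodule.mul_mem_mul (word_mem_degreePart _) hρ)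
      (word_mem_degreePart _)
  have h0 := hv _ hI hd U a h
  have hc : ∀ (m : ℕ) (hm : m < k + 2 + r), coordSeq t h m (a ⟨m, hm⟩) = 1 := fun m hm =>
    (dif_pos hm).trans (coord_self _ _)
  rw [evalForm_eq_pathAction, map_mul, map_mul, Module.End.mul_apply, Module.End.mul_apply,
    pathAction_word] at h0
  have hu : ∏ m : Fin k, coordSeq t h (0 + m) (a ⟨m, by omega⟩) = 1 :=
    Finset.prod_eq_one fun m _ => by rw [zero_add]; exact hc m (by omega)
  have hψ : pathAction (coordSeq t h) v (Pi.single (k + 2 + r) 1) (k + 1 + 1) = 1 := by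
    rw [pathAction_word, Pi.single_eq_same, mul_one]
    exact Finset.prod_eq_one fun m _ => hc _ (by omega)
  rw [hu, one_mul, zero_add] at h0
  simp only [ρ, map_sub, map_mul, map_smul, LinearMap.sub_apply, LinearMap.smul_apply,
    Module.End.mul_apply, Pi.sub_apply, Pi.smul_apply, pathAction_ι, hψ, mul_one] at h0
  rw [Algebra.smul_def] at h0
  simp only [coordSeq, dif_pos hk, dif_pos (k.lt_succ_self.trans hk)] at h0
  exact sub_eq_zero.1 h0

end

end SkewProj

namespace SkewProj

variable {K : Type u} [Field K] {n : ℕ}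

/-! ### The closed subscheme defined by the cubic forms -/

/-- Passing from chart $b$ to chart $a$ multiplies a cubic by $(X_b/X_a)^3$, so one chart containing
the whole image is enough. -/
theorem cubicsVanish_of_top {ω : Fin n → Fin n → K} {T : Over (Spec (.of K))}
    {t : T ⟶ projSpace K n} {b : Fin n} (hb : ⊤ ≤ t.left ⁻¹ᵁ chart K n b)
    (h : ∀ i j k, qNumber ω i j k ≠ 1 → coord t hb i * coord t hb j * coord t hb k = 0) :
    CubicsVanish ω t := by
  intro U a ha i j k hq
  have h1 := congrArg (T.left.presheaf.map (homOfLE (le_top : U ≤ ⊤)).op) (h i j k hq)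
  simp only [map_mul, coord_res, map_zero] at h1
  rw [← coord_mul t ha (le_top.trans hb) i, ← coord_mul t ha (le_top.trans hb) j,
    ← coord_mul t ha (le_top.trans hb) k]
  linear_combination (coord t ha b) ^ 3 * h1

/-- The ideal of the cubic forms in the ring of functions `K[X_1, ..., X_n] / (X_a - 1)` of a
standard open. -/
def cubicIdeal (ω : Fin n → Fin n → K) (a : Fin n) : Ideal (MvPolynomial (Fin n) K) :=
  Ideal.span ({MvPolynomial.X a - 1} ∪ {p | ∃ i j k, qNumber ω i j k ≠ 1 ∧
    p = MvPolynomial.X i * MvPolynomial.X j * MvPolynomial.X k})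

theorem hom_Spec_scalar (R : CommRingCat.{u}) (c : CommRingCat.of K ⟶ R) (r : K) :
    scalar (Over.mk (Spec.map c)) ⊤ r = (Scheme.ΓSpecIso R).inv.hom (c.hom r) := by
  have h : (Scheme.ΓSpecIso (.of K)).inv ≫ (Spec.map c).appLE ⊤ ⊤ le_top =
      c ≫ (Scheme.ΓSpecIso R).inv := by
    rw [Scheme.ΓSpecIso_inv_naturality]
    congr 1
  exact DFunLike.congr_fun (congrArg CommRingCat.Hom.hom h) r

theorem exists_hom_Spec (T : Over (Spec (.of K))) (R : CommRingCat.{u}) (c : CommRingCat.of K ⟶ R)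
    (φ : R ⟶ Γ(T.left, ⊤)) (hφ : ∀ r, φ.hom (c.hom r) = scalar T ⊤ r) :
    ∃ g : T ⟶ Over.mk (Spec.map c), ∀ z,
      (g.left.appLE ⊤ ⊤ le_top).hom ((Scheme.ΓSpecIso R).inv.hom z) = φ.hom z := by
  have h2 : (T.left.toSpecΓ ≫ Spec.map φ).appLE ⊤ ⊤ le_top = (Scheme.ΓSpecIso R).hom ≫ φ := by
    refine (Scheme.Hom.appLE_eq_app (T.left.toSpecΓ ≫ Spec.map φ)).trans ?_
    change (T.left.toSpecΓ ≫ Spec.map φ).appTop = _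
    rw [Scheme.Hom.comp_appTop, Scheme.toSpecΓ_appTop, Scheme.ΓSpecIso_naturality]
  have hw : (T.left.toSpecΓ ≫ Spec.map φ) ≫ Spec.map c = T.hom := by
    apply hom_to_Spec_ext
    refine (Scheme.Hom.appLE_comp_appLE (T.left.toSpecΓ ≫ Spec.map φ) (Spec.map c) ⊤ ⊤ ⊤ le_top
      le_top).symm.trans ?_
    rw [h2, ← cancel_epi (Scheme.ΓSpecIso (.of K)).inv]
    ext r
    have h3 := hom_Spec_scalar R c r
    refine Eq.trans ?_ (hφ r)
    change φ.hom ((Scheme.ΓSpecIso R).hom.hom (scalar (Over.mk (Spec.map c)) ⊤ r)) = _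
    rw [h3]
    exact congrArg φ.hom (DFunLike.congr_fun
      (congrArg CommRingCat.Hom.hom (Scheme.ΓSpecIso R).inv_hom_id) _)
  refine ⟨Over.homMk (T.left.toSpecΓ ≫ Spec.map φ) hw, fun z => ?_⟩
  refine (DFunLike.congr_fun (congrArg CommRingCat.Hom.hom h2) _).trans ?_
  exact congrArg φ.hom (DFunLike.congr_fun
    (congrArg CommRingCat.Hom.hom (Scheme.ΓSpecIso R).inv_hom_id) _)

theorem exists_chart_model (ω : Fin n → Fin n → K) (a : Fin n) :
    ∃ (A : Over (Spec (.of K))) (f : A ⟶ projSpace K n), QuasiCompact f.left ∧ CubicsVanish ω f ∧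
      ∀ (T : Over (Spec (.of K))) (t : T ⟶ projSpace K n), ⊤ ≤ t.left ⁻¹ᵁ chart K n a →
        CubicsVanish ω t → ∃ g : T ⟶ A, g ≫ f = t := by
  let R : CommRingCat.{u} := .of (MvPolynomial (Fin n) K ⧸ cubicIdeal ω a)
  let c : CommRingCat.of K ⟶ R := CommRingCat.ofHom (algebraMap K _)
  let x : Fin n → R := fun j => Ideal.Quotient.mk (cubicIdeal ω a) (MvPolynomial.X j)
  have hxa : x a = 1 := by
    rw [← sub_eq_zero]
    exact (map_sub (Ideal.Quotient.mk (cubicIdeal ω a)) _ _).symm.trans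
      (Ideal.Quotient.eq_zero_iff_mem.2 (Ideal.subset_span (Or.inl rfl)))
  have hxc : ∀ i j k, qNumber ω i j k ≠ 1 → x i * x j * x k = 0 := fun i j k hq =>
    Ideal.Quotient.eq_zero_iff_mem.2 (Ideal.subset_span (Or.inr ⟨i, j, k, hq, rfl⟩))
  obtain ⟨f, hf, hfx⟩ := exists_hom_of_coord (Over.mk (Spec.map c)) a
    (fun j => (Scheme.ΓSpecIso R).inv.hom (x j)) (by rw [hxa, map_one])
  refine ⟨_, f, ?_, ?_, fun T t ht htc => ?_⟩
  -- Quasi-compactness ensures that the kernel ideal sheaf is computed on affine opens by kernels of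
  -- maps on sections.
  · have h1 : QuasiCompact (f.left ≫ (projSpace K n).hom) := by
      rw [Over.w f]
      exact (inferInstance : QuasiCompact (Spec.map c))
    have h2 : QuasiSeparated (projSpace K n).hom :=
      (inferInstance : QuasiSeparated (Proj.toSpecZero (grading K n) ≫
        Spec.map (CommRingCat.ofHom (algebraMap K (grading K n 0)))))
    exact QuasiCompact.of_comp f.left (projSpace K n).hom
  · refine cubicsVanish_of_top hf fun i j k hq => ?_
    rw [hfx, hfx, hfx, ← map_mul, ← map_mul, hxc i j k hq, map_zero]
  · have hI : ∀ p ∈ cubicIdeal ω a, MvPolynomial.eval₂Hom (scalar T ⊤) (coord t ht) p = 0 := by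
      intro p hp
      refine (Ideal.span_le (I := RingHom.ker _)).2 ?_ hp
      rintro _ (rfl | ⟨i, j, k, hq, rfl⟩)
      · simp [RingHom.mem_ker, coord_self]
      · simpa [RingHom.mem_ker] using htc _ _ ht i j k hq
    obtain ⟨g, hg⟩ := exists_hom_Spec T R c (CommRingCat.ofHom (Ideal.Quotient.lift _ _ hI))
      (fun r => MvPolynomial.eval₂Hom_C (scalar T ⊤) (coord t ht) r)
    have hgf : ⊤ ≤ (g ≫ f).left ⁻¹ᵁ chart K n a := fun x _ => hf (x := g.left x) trivial
    refine ⟨g, hom_ext_of_coord _ _ fun y => ⟨⊤, a, hgf, ht, trivial, fun j => ?_⟩⟩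
    rw [coord_comp f g le_top hf, hfx, hg]
    exact MvPolynomial.eval₂Hom_X' (scalar T ⊤) (coord t ht) j

theorem appLE_eq_zero {X Y : Scheme.{u}} {f : X ⟶ Y} {U : Y.Opens} {s : Γ(Y, U)}
    (h : (f.app U).hom s = 0) {V : X.Opens} (hV : V ≤ f ⁻¹ᵁ U) : (f.appLE U V hV).hom s = 0 := by
  rw [Scheme.Hom.appLE, CommRingCat.hom_comp, RingHom.comp_apply, h, map_zero]

theorem app_eq_zero_of_comp_eq {X Y Z : Scheme.{u}} {g : X ⟶ Y} {f : Y ⟶ Z} {k : X ⟶ Z}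
    (hk : g ≫ f = k) {U : Z.Opens} {s : Γ(Z, U)} (h : (f.app U).hom s = 0) :
    (k.app U).hom s = 0 := by
  subst hk
  have h1 := congrArg (fun φ => φ.hom s) (Scheme.Hom.comp_app g f U)
  exact h1.trans ((congrArg (g.app _).hom h).trans (map_zero _))

theorem exists_factor_subschemeι {T Y : Over (Spec (.of K))} (t : T ⟶ Y)
    (J : Y.left.IdealSheafData) (hJ : J ≤ t.left.ker) :
    ∃ g : T ⟶ Over.mk (J.subschemeι ≫ Y.hom), g.left ≫ J.subschemeι = t.left := by
  refine ⟨Over.homMk (t.left.toImage ≫ Scheme.IdealSheafData.inclusion hJ) ?_, ?_⟩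
  · refine Eq.trans ?_ (Over.w t)
    change (t.left.toImage ≫ Scheme.IdealSheafData.inclusion hJ) ≫ J.subschemeι ≫ _ = _
    rw [Category.assoc, Scheme.IdealSheafData.inclusion_subschemeι_assoc]
    exact Scheme.Hom.toImage_imageι_assoc t.left _
  · change (t.left.toImage ≫ Scheme.IdealSheafData.inclusion hJ) ≫ J.subschemeι = _
    rw [Category.assoc, Scheme.IdealSheafData.inclusion_subschemeι]
    exact Scheme.Hom.toImage_imageι t.left

/-- The ideal sheaf is the intersection of the kernels of the affine chart models. It contains the
cubics, since they pull back to zero on every model; and a point satisfying the cubics factors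
locally through a model, so it kills this ideal. -/
theorem exists_cubicScheme (ω : Fin n → Fin n → K) :
    ∃ (E : Over (Spec (.of K))) (ι : E ⟶ projSpace K n), IsClosedImmersion ι.left ∧
      CubicsVanish ω ι ∧ ∀ (T : Over (Spec (.of K))) (t : T ⟶ projSpace K n),
        CubicsVanish ω t → ∃ g : T ⟶ E, g ≫ ι = t := by
  choose A f hqc hfc hlift using exists_chart_model (K := K) ω
  let J : (projSpace K n).left.IdealSheafData := ⨅ a, (f a).left.ker
  refine ⟨Over.mk (J.subschemeι ≫ (projSpace K n).hom), Over.homMk J.subschemeι, ?_, ?_,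
    fun T t ht => ?_⟩
  · exact (inferInstance : IsClosedImmersion J.subschemeι)
  · intro U a ha i j k hq
    have hJ : ratio K n a i * ratio K n a j * ratio K n a k ∈
        J.ideal ⟨chart K n a, isAffineOpen_chart a⟩ := by
      rw [Scheme.IdealSheafData.ideal_iInf, iInf_apply, Submodule.mem_iInf]
      intro b
      rw [Scheme.Hom.ker_apply, RingHom.mem_ker, Scheme.Hom.app_eq_appLE, map_mul, map_mul]
      exact hfc b _ a le_rfl i j k hq
    have h0 : (J.subschemeι.app (chart K n a)).hom
        (ratio K n a i * ratio K n a j * ratio K n a k) = 0 := by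
      have := J.ker_subschemeι_app ⟨chart K n a, isAffineOpen_chart a⟩
      rw [← this] at hJ
      exact hJ
    have h1 : (J.subschemeι.appLE (chart K n a) U ha).hom
        (ratio K n a i * ratio K n a j * ratio K n a k) = 0 := appLE_eq_zero h0 _
    rw [map_mul, map_mul] at h1
    exact h1
  · have hJ : J ≤ t.left.ker := by
      refine Scheme.IdealSheafData.le_ofIdeals_iff.2 fun W s hs => ?_
      refine section_eq_zero_of_nhds _ fun x hx => ?_
      obtain ⟨a, V, hxV, -, ha⟩ := exists_chart_nhd t ⊤ x trivial
      obtain ⟨g, hg⟩ := hlift a (openOver T V) (openOverι T V ≫ t) (fun y _ => ha y.2) (ht.comp _)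
      have hs0 : ((f a).left.app W).hom s = 0 := by
        have := iInf_le (fun a => (f a).left.ker) a W hs
        exact (f a).left.ideal_ker_le W this
      have hg' : g.left ≫ (f a).left = V.ι ≫ t.left := congrArg (fun f => f.left) hg
      have h1 : ((V.ι ≫ t.left).app W).hom s = 0 :=
        app_eq_zero_of_comp_eq hg' hs0
      rw [Scheme.Hom.comp_app, Scheme.Opens.ι_app] at h1
      exact ⟨V.ι ''ᵁ V.ι ⁻¹ᵁ (t.left ⁻¹ᵁ W), _, ⟨⟨x, hxV⟩, hx, rfl⟩, h1⟩
    obtain ⟨g, hg⟩ := exists_factor_subschemeι t J hJ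
    exact ⟨g, Over.OverMorphism.ext hg⟩

end SkewProj

namespace SkewProj

variable {K : Type u} [Field K] {n : ℕ}

/-! ### The inverse system of the schemes `Ω_i` and its limit -/

theorem isOmega_zero (I : TwoSidedIdeal (FreeAlgebra K (Fin n)))
    (hI : ∀ {T : Over (Spec (.of K))} (t : Fin 0 → (T ⟶ projSpace K n)), Vanishes I t)
    (p : Fin 0 → (Over.mk (𝟙 (Spec (.of K))) ⟶ projSpace K n)) : IsOmega I p where
  vanishes := hI p
  existsUnique_lift T _ _ :=
    ⟨Over.mkIdTerminal.from T, fun k => k.elim0, fun _ _ => Over.mkIdTerminal.hom_ext _ _⟩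

theorem isOmega_one (I : TwoSidedIdeal (FreeAlgebra K (Fin n)))
    (hI : ∀ {T : Over (Spec (.of K))} (t : Fin 1 → (T ⟶ projSpace K n)), Vanishes I t) :
    IsOmega I (fun _ : Fin 1 => 𝟙 (projSpace K n)) where
  vanishes := hI _
  existsUnique_lift T t _ :=
    ⟨t 0, fun k => by rw [Category.comp_id, Subsingleton.elim k 0], fun g hg => by
      rw [← hg 0, Category.comp_id]⟩

section

variable {ω : Fin n → Fin n → K} (hω : ∀ i j, ω i j * ω j i = 1) (hdiag : ∀ i, ω i i = 1)
  {E T : Over (Spec (.of K))} {ι : E ⟶ projSpace K n}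

include hω hdiag in
theorem CubicsVanish.exists_orbit (hι : CubicsVanish ω ι) :
    ∃ τ : ℕ → (E ⟶ projSpace K n), τ 0 = ι ∧ ∀ k, Related ω (τ k) (τ (k + 1)) := by
  have h : ∀ t : {t : E ⟶ projSpace K n // CubicsVanish ω t},
      ∃ t' : {t : E ⟶ projSpace K n // CubicsVanish ω t}, Related ω t.1 t'.1 := fun t => by
    obtain ⟨t', ht'⟩ := t.2.exists_related hω hdiag
    exact ⟨⟨t', ht'.cubicsVanish_right hω⟩, ht'⟩
  choose F hF using h
  refine ⟨fun k => (F^[k] ⟨ι, hι⟩).1, rfl, fun k => ?_⟩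
  change Related ω _ (F^[k + 1] ⟨ι, hι⟩).1
  rw [Function.iterate_succ_apply']
  exact hF _

theorem comp_orbit_eq {τ : ℕ → (E ⟶ projSpace K n)} (hτ : ∀ k, Related ω (τ k) (τ (k + 1)))
    {i : ℕ} {t : Fin i → (T ⟶ projSpace K n)}
    (ht : ∀ k (hk : k + 1 < i), Related ω (t ⟨k, by omega⟩) (t ⟨k + 1, hk⟩)) (hi : 0 < i)
    {g : T ⟶ E} (hg : g ≫ τ 0 = t ⟨0, hi⟩) (k : ℕ) (hk : k < i) : g ≫ τ k = t ⟨k, hk⟩ := by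
  induction k with
  | zero => exact hg
  | succ k ih =>
    have h1 := (hτ k).comp g
    rw [ih (by omega)] at h1
    exact h1.right_unique (ht k hk)

include hω in
-- A tuple is determined by its first point through uniqueness of successors. That point lies on $E$
-- because it has a successor, which is why at least two points are needed.
theorem isOmega_orbit (hmono : Mono ι)
    (hlift : ∀ (T : Over (Spec (.of K))) (t : T ⟶ projSpace K n), CubicsVanish ω t →
      ∃ g : T ⟶ E, g ≫ ι = t)
    {τ : ℕ → (E ⟶ projSpace K n)} (h0 : τ 0 = ι) (hτ : ∀ k, Related ω (τ k) (τ (k + 1)))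
    {i : ℕ} (hi : 2 ≤ i) : IsOmega (skewIdeal ω) (fun k : Fin i => τ k) where
  vanishes := vanishes_of_related fun k _ => hτ k
  existsUnique_lift T t ht := by
    have ht' := fun k hk => Vanishes.related ht k hk
    obtain ⟨g, hg⟩ := hlift T (t ⟨0, by omega⟩) ((ht' 0 hi).cubicsVanish hω)
    refine ⟨g, fun k => comp_orbit_eq hτ ht' (by omega) (by rw [h0, hg]) k k.2, fun g' hg' => ?_⟩
    rw [← cancel_mono ι, hg, ← h0]
    exact hg' ⟨0, by omega⟩

end

theorem Vanishes.comp {ω : Fin n → Fin n → K} {T T' : Over (Spec (.of K))} {i : ℕ}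
    {t : Fin i → (T ⟶ projSpace K n)} (ht : Vanishes (skewIdeal ω) t) (g : T' ⟶ T) :
    Vanishes (skewIdeal ω) fun k => g ≫ t k :=
  vanishes_of_related fun k hk => (Vanishes.related ht k hk).comp g

theorem Vanishes.castLE {ω : Fin n → Fin n → K} {T : Over (Spec (.of K))} {i j : ℕ}
    {t : Fin j → (T ⟶ projSpace K n)} (ht : Vanishes (skewIdeal ω) t) (h : i ≤ j) :
    Vanishes (skewIdeal ω) fun k : Fin i => t (Fin.castLE h k) :=
  vanishes_of_related fun k hk => Vanishes.related ht k (hk.trans_le h)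

theorem IsOmega.hom_ext {ω : Fin n → Fin n → K} {T Z : Over (Spec (.of K))} {i : ℕ}
    {p : Fin i → (Z ⟶ projSpace K n)} (hp : IsOmega (skewIdeal ω) p) {g g' : T ⟶ Z}
    (h : ∀ k, g ≫ p k = g' ≫ p k) : g = g' :=
  (hp.existsUnique_lift T _ (hp.vanishes.comp g')).unique h fun _ => rfl

theorem exists_omegaSystem (ω : Fin n → Fin n → K)
    (h : ∀ i, ∃ (Z : Over (Spec (.of K))) (p : Fin i → (Z ⟶ projSpace K n)),
      IsOmega (skewIdeal ω) p) : Nonempty (OmegaSystem (skewIdeal ω)) := by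
  choose Z p hp using h
  choose m hm using fun (i j : ℕ) (h : i ≤ j) =>
    ((hp i).existsUnique_lift _ _ ((hp j).vanishes.castLE h)).exists
  let F : ℕᵒᵖ ⥤ Over (Spec (.of K)) :=
    { obj := fun i => Z i.unop
      map := fun {j i} f => m i.unop j.unop (leOfHom f.unop)
      map_id := fun i => (hp _).hom_ext fun k => by rw [hm, Category.id_comp]; rfl
      map_comp := fun {l j i} f g => (hp _).hom_ext fun k => by
        rw [hm, Category.assoc, hm, hm]; rfl }
  exact ⟨⟨F, p, hp, fun i j h k => hm i j h k⟩⟩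

/-- A cone is a compatible infinite sequence of related points, hence the orbit of a single point of
$E$. -/
theorem exists_isLimit_omegaSystem {ω : Fin n → Fin n → K} (hω : ∀ i j, ω i j * ω j i = 1)
    (S : OmegaSystem (skewIdeal ω)) {E : Over (Spec (.of K))} {ι : E ⟶ projSpace K n}
    (hmono : Mono ι)
    (hlift : ∀ (T : Over (Spec (.of K))) (t : T ⟶ projSpace K n), CubicsVanish ω t →
      ∃ g : T ⟶ E, g ≫ ι = t)
    {τ : ℕ → (E ⟶ projSpace K n)} (h0 : τ 0 = ι) (hτ : ∀ k, Related ω (τ k) (τ (k + 1))) :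
    ∃ c : Cone S.Ω, c.pt = E ∧ Nonempty (IsLimit c) := by
  choose π hπ using fun i : ℕ => ((S.isOmega i).existsUnique_lift E (fun k : Fin i => τ k)
    (vanishes_of_related fun k _ => hτ k)).exists
  let c : Cone S.Ω :=
    { pt := E
      π :=
        { app := fun i => π i.unop
          naturality := fun j i f => (S.isOmega i.unop).hom_ext fun k => by
            refine (congrArg (· ≫ _) (Category.id_comp _)).trans ((hπ _ _).trans ?_)
            have h1 := S.pr_p i.unop j.unop (leOfHom f.unop) k
            rw [Category.assoc]
            exact ((congrArg (π j.unop ≫ ·) h1).trans (hπ _ _)).symm } }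
  have hs : ∀ (s : Cone S.Ω) (i j : ℕ) (hij : i ≤ j) (k : Fin i),
      s.π.app (op i) ≫ S.p i k = s.π.app (op j) ≫ S.p j (Fin.castLE hij k) := by
    intro s i j hij k
    rw [← s.w (homOfLE hij).op, Category.assoc, S.pr_p]
  have hv : ∀ (s : Cone S.Ω) (i : ℕ), Vanishes (skewIdeal ω) fun k => s.π.app (op i) ≫ S.p i k :=
    fun s i => (S.isOmega i).vanishes.comp _
  -- The first point is read off in $\Omega_2$, where the existence of a second point already forces
  -- the cubics to vanish.
  choose g hg using fun s : Cone S.Ω => hlift _ (s.π.app (op 2) ≫ S.p 2 0)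
    (((hv s 2).related 0 (by omega)).cubicsVanish hω)
  refine ⟨c, rfl, ⟨⟨g, fun s i => (S.isOmega i.unop).hom_ext fun k => ?_, fun s f hf => ?_⟩⟩⟩
  · obtain ⟨i⟩ := i
    -- The comparison takes place in $\Omega_{i+2}$, which has a first coordinate even when $i=0$.
    have hg0 : g s ≫ τ 0 = s.π.app (op (i + 2)) ≫ S.p (i + 2) ⟨0, by omega⟩ := by
      rw [h0]
      exact (hg s).trans (hs s 2 (i + 2) (by omega) 0)
    have hr : ∀ k (hk : k + 1 < i + 2),
        Related ω (s.π.app (op (i + 2)) ≫ S.p (i + 2) ⟨k, by omega⟩)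
          (s.π.app (op (i + 2)) ≫ S.p (i + 2) ⟨k + 1, hk⟩) :=
      fun k hk => (hv s (i + 2)).related k hk
    have hk : k.1 < i + 2 := Nat.lt_add_right 2 k.2
    have h1 := comp_orbit_eq hτ (t := fun k => s.π.app (op (i + 2)) ≫ S.p (i + 2) k) hr
      (by omega) hg0 k.1 hk
    have h2 := hs s i (i + 2) (by omega) k
    rw [Category.assoc]
    exact (congrArg (g s ≫ ·) (hπ i k)).trans (h1.trans h2.symm)
  · rw [← cancel_mono ι, hg, ← hf (op 2), ← h0, Category.assoc]
    exact (congrArg (f ≫ ·) (hπ 2 0)).symm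

theorem isPointVariety_of_iso {ω : Fin n → Fin n → K} (hω : ∀ i j, ω i j * ω j i = 1)
    (hdiag : ∀ i, ω i i = 1) {E Y : Over (Spec (.of K))} {ι : E ⟶ projSpace K n} (hmono : Mono ι)
    (hι : CubicsVanish ω ι)
    (hlift : ∀ (T : Over (Spec (.of K))) (t : T ⟶ projSpace K n), CubicsVanish ω t →
      ∃ g : T ⟶ E, g ≫ ι = t)
    (e : Y ≅ reducedOn E ⊤) : IsPointVariety (skewIdeal ω) Y := by
  obtain ⟨τ, h0, hτ⟩ := hι.exists_orbit hω hdiag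
  obtain ⟨S⟩ := exists_omegaSystem ω fun i => by
    match i with
    | 0 => exact ⟨_, fun k => k.elim0,
        isOmega_zero _ (fun t => vanishes_of_related fun k hk => by omega) _⟩
    | 1 => exact ⟨_, _, isOmega_one _ fun t => vanishes_of_related fun k hk => by omega⟩
    | i + 2 => exact ⟨_, _, isOmega_orbit hω hmono hlift h0 hτ (by omega)⟩
  obtain ⟨c, rfl, hc⟩ := exists_isLimit_omegaSystem hω S hmono hlift h0 hτ
  exact ⟨S, c, hc, ⟨e⟩⟩

end SkewProj

namespace SkewProj

variable {K : Type u} [Field K] {n : ℕ}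

/-! ### Reduced induced structures -/

theorem isReduced_subscheme {X : Scheme.{u}} (J : X.IdealSheafData)
    (hJ : ∀ U, (J.ideal U).IsRadical) : AlgebraicGeometry.IsReduced J.subscheme := by
  have h : ∀ U, AlgebraicGeometry.IsReduced (J.subschemeCover.openCover.X U) := fun U => by
    have : _root_.IsReduced (Γ(X, U.1) ⧸ J.ideal U) :=
      (Ideal.isRadical_iff_quotient_reduced _).1 (hJ U)
    exact (inferInstance : AlgebraicGeometry.IsReduced (Spec (.of (Γ(X, U.1) ⧸ J.ideal U))))
  exact IsReduced.of_openCover _ J.subschemeCover.openCover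

theorem isReduced_subscheme_vanishingIdeal {X : Scheme.{u}} (Z : TopologicalSpace.Closeds X) :
    AlgebraicGeometry.IsReduced (Scheme.IdealSheafData.vanishingIdeal Z).subscheme := by
  refine isReduced_subscheme _ fun U => ?_
  rw [Scheme.IdealSheafData.vanishingIdeal_ideal]
  exact PrimeSpectrum.isRadical_vanishingIdeal _

/-- On a reduced scheme a section with empty nonvanishing locus is zero, so a set-theoretic
factorization is scheme-theoretic. -/
theorem vanishingIdeal_le_ker {X Y : Scheme.{u}} [AlgebraicGeometry.IsReduced X] (f : X ⟶ Y)
    (Z : TopologicalSpace.Closeds Y) (h : ∀ x, f x ∈ Z) :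
    Scheme.IdealSheafData.vanishingIdeal Z ≤ f.ker := by
  refine Scheme.IdealSheafData.le_ofIdeals_iff.2 fun U s hs => ?_
  refine eq_zero_of_basicOpen_eq_bot _ (le_bot_iff.1 fun x hx => ?_)
  have hx' : f x ∈ Y.basicOpen s := by
    rw [← Scheme.preimage_basicOpen] at hx
    exact hx
  have h1 : f x ∈ (Scheme.IdealSheafData.vanishingIdeal Z).supportSet := by
    rw [Scheme.IdealSheafData.mem_supportSet_iff_mem_support, ← SetLike.mem_coe,
      Scheme.IdealSheafData.coe_support_vanishingIdeal]
    exact h x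
  have h2 := Scheme.IdealSheafData.supportSet_subset_zeroLocus _ U h1
  rw [Scheme.mem_zeroLocus_iff] at h2
  exact h2 s hs hx'

/-- The inclusion of a closed subset with its reduced induced structure. -/
def reducedι (X : Over (Spec (.of K))) (Z : TopologicalSpace.Closeds X.left) :
    reducedOn X Z ⟶ X :=
  Over.homMk (Scheme.IdealSheafData.vanishingIdeal Z).subschemeι

section

variable {X Y : Over (Spec (.of K))}

theorem isReduced_reducedOn (Z : TopologicalSpace.Closeds X.left) :
    AlgebraicGeometry.IsReduced (reducedOn X Z).left :=
  isReduced_subscheme_vanishingIdeal Z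

theorem reducedι_mem (Z : TopologicalSpace.Closeds X.left) (x : (reducedOn X Z).left) :
    (reducedι X Z).left x ∈ Z := by
  have h : (Scheme.IdealSheafData.vanishingIdeal Z).subschemeι x ∈
      Set.range (Scheme.IdealSheafData.vanishingIdeal Z).subschemeι := ⟨x, rfl⟩
  rw [Scheme.IdealSheafData.range_subschemeι, Scheme.IdealSheafData.coe_support_vanishingIdeal] at h
  exact h

theorem mono_reducedι (Z : TopologicalSpace.Closeds X.left) : Mono (reducedι X Z) := by
  have : Mono (reducedι X Z).left :=
    (inferInstance : Mono (Scheme.IdealSheafData.vanishingIdeal Z).subschemeι)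
  exact Over.mono_of_mono_left _

theorem exists_lift_reducedι (h : AlgebraicGeometry.IsReduced X.left) (f : X ⟶ Y)
    (Z : TopologicalSpace.Closeds Y.left) (hf : ∀ x, f.left x ∈ Z) :
    ∃ g : X ⟶ reducedOn Y Z, g ≫ reducedι Y Z = f := by
  obtain ⟨g, hg⟩ := exists_factor_subschemeι f _ (vanishingIdeal_le_ker f.left Z hf)
  exact ⟨g, Over.OverMorphism.ext hg⟩

theorem nonempty_iso_of_factor {C : Type*} [Category* C] {A B P : C} {i : A ⟶ P} {j : B ⟶ P}
    (hi : Mono i) (hj : Mono j) (h : ∃ a, a ≫ j = i) (h' : ∃ b, b ≫ i = j) :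
    Nonempty (A ≅ B) := by
  obtain ⟨a, ha⟩ := h
  obtain ⟨b, hb⟩ := h'
  exact ⟨⟨a, b, by rw [← cancel_mono i, Category.assoc, hb, ha, Category.id_comp],
    by rw [← cancel_mono j, Category.assoc, ha, hb, Category.id_comp]⟩⟩

theorem nonempty_iso_reducedOn (e : X ≅ Y) (Z : TopologicalSpace.Closeds X.left)
    (Z' : TopologicalSpace.Closeds Y.left) (h : ∀ x, x ∈ Z ↔ e.hom.left x ∈ Z') :
    Nonempty (reducedOn X Z ≅ reducedOn Y Z') := by
  have := mono_reducedι Z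
  have := mono_reducedι Z'
  have hi : ∀ y, e.hom.left (e.inv.left y) = y := fun y => by
    have h1 := congrArg (fun f => f.left) e.inv_hom_id
    exact congrArg (fun f : Y.left ⟶ Y.left => f y) h1
  refine nonempty_iso_of_factor (mono_comp (reducedι X Z) e.hom) (mono_reducedι Z')
    (exists_lift_reducedι (isReduced_reducedOn Z) _ Z' fun x => (h _).1 (reducedι_mem Z x)) ?_
  obtain ⟨g, hg⟩ := exists_lift_reducedι (isReduced_reducedOn Z') (reducedι Y Z' ≫ e.inv) Z
    fun x => (h _).2 (by
      have h2 : e.hom.left ((reducedι Y Z' ≫ e.inv).left x) = (reducedι Y Z').left x := hi _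
      rw [h2]
      exact reducedι_mem Z' x)
  exact ⟨g, by rw [← Category.assoc, hg, Category.assoc, e.inv_hom_id, Category.comp_id]⟩

theorem nonempty_iso_reducedOn_top (h : AlgebraicGeometry.IsReduced X.left) :
    Nonempty (reducedOn X ⊤ ≅ X) :=
  nonempty_iso_of_factor (mono_reducedι ⊤) (inferInstance : Mono (𝟙 X))
    ⟨_, Category.comp_id _⟩ (exists_lift_reducedι h _ _ fun _ => trivial)

end

/-- The closed set cut out by the cubic forms `X_i X_j X_k` with `q_{(ijk)} ≠ 1`. -/
def IsCubicLocus (ω : Fin n → Fin n → K) (Z : TopologicalSpace.Closeds (projSpace K n).left) :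
    Prop :=
  ∀ x, x ∈ Z ↔ ∀ i j k, qNumber ω i j k ≠ 1 →
    ¬ (x ∈ chart K n i ∧ x ∈ chart K n j ∧ x ∈ chart K n k)

theorem basicOpen_coord_mul {T : Over (Spec (.of K))} (t : T ⟶ projSpace K n) {U : T.left.Opens}
    {a : Fin n} (ha : U ≤ t.left ⁻¹ᵁ chart K n a) (i j k : Fin n) :
    T.left.basicOpen (coord t ha i * coord t ha j * coord t ha k) =
      (U ⊓ t.left ⁻¹ᵁ chart K n i) ⊓ (U ⊓ t.left ⁻¹ᵁ chart K n j) ⊓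
        (U ⊓ t.left ⁻¹ᵁ chart K n k) := by
  rw [Scheme.basicOpen_mul, Scheme.basicOpen_mul, basicOpen_coord, basicOpen_coord,
    basicOpen_coord]

theorem CubicsVanish.mem_isCubicLocus {ω : Fin n → Fin n → K}
    {Z : TopologicalSpace.Closeds (projSpace K n).left} (hZ : IsCubicLocus ω Z)
    {T : Over (Spec (.of K))} {t : T ⟶ projSpace K n} (ht : CubicsVanish ω t) (x : T.left) :
    t.left x ∈ Z := by
  rw [hZ]
  rintro i j k hq ⟨hi, hj, hk⟩
  have h1 := basicOpen_coord_mul t (le_refl (t.left ⁻¹ᵁ chart K n i)) i j k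
  rw [ht _ _ _ i j k hq, Scheme.basicOpen_zero] at h1
  have h2 : x ∈ (⊥ : T.left.Opens) := by
    rw [h1]
    exact ⟨⟨⟨hi, hi⟩, ⟨hi, hj⟩⟩, ⟨hi, hk⟩⟩
  exact h2

theorem cubicsVanish_of_isReduced {ω : Fin n → Fin n → K}
    {Z : TopologicalSpace.Closeds (projSpace K n).left} (hZ : IsCubicLocus ω Z)
    {T : Over (Spec (.of K))} (hT : AlgebraicGeometry.IsReduced T.left) {t : T ⟶ projSpace K n}
    (ht : ∀ x, t.left x ∈ Z) : CubicsVanish ω t := by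
  intro U a ha i j k hq
  refine eq_zero_of_basicOpen_eq_bot _ (le_bot_iff.1 fun x hx => ?_)
  rw [basicOpen_coord_mul] at hx
  exact ((hZ _).1 (ht x) i j k hq ⟨hx.1.1.2, hx.1.2.2, hx.2.2⟩).elim

/-- The reduced locus satisfies the cubics and so maps to $E$; conversely the reduction of $E$ lands
in the locus. Both are subobjects of projective space, hence isomorphic. -/
theorem isPointVariety_of_isCubicLocus {ω : Fin n → Fin n → K} (hω : ∀ i j, ω i j * ω j i = 1)
    (hdiag : ∀ i, ω i i = 1) {Z : TopologicalSpace.Closeds (projSpace K n).left}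
    (hZ : IsCubicLocus ω Z) {Y : Over (Spec (.of K))}
    (hY : Nonempty (Y ≅ reducedOn (projSpace K n) Z)) : IsPointVariety (skewIdeal ω) Y := by
  obtain ⟨E, ι, hcl, hι, hlift⟩ := exists_cubicScheme (K := K) ω
  have hmono : Mono ι := Over.mono_of_mono_left _
  obtain ⟨e⟩ := hY
  have := mono_reducedι (⊤ : TopologicalSpace.Closeds E.left)
  obtain ⟨e'⟩ := nonempty_iso_of_factor (mono_reducedι Z) (mono_comp (reducedι E ⊤) ι) (by
    obtain ⟨g, hg⟩ := hlift _ _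
      (cubicsVanish_of_isReduced hZ (isReduced_reducedOn Z) (reducedι_mem Z))
    obtain ⟨g', hg'⟩ := exists_lift_reducedι (isReduced_reducedOn Z) g ⊤ fun _ => trivial
    exact ⟨g', by rw [← Category.assoc, hg', hg]⟩)
    (exists_lift_reducedι (isReduced_reducedOn ⊤) _ Z fun x => (hι.comp _).mem_isCubicLocus hZ x)
  exact isPointVariety_of_iso hω hdiag hmono hι hlift (e ≪≫ e')

end SkewProj

namespace SkewProj

variable {K : Type u} [Field K] {n : ℕ}

/-! ### Permutations of the coordinates -/

/-- On the preimage of chart $a$ the coordinates are the permuted ratios. The equalities `s a = b`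
and `s j = k` remain hypotheses so that chart indices need not literally have the form `s a`. -/
theorem exists_permHom (s : Equiv.Perm (Fin n)) :
    ∃ t : projSpace K n ⟶ projSpace K n, ∀ a b, s a = b →
      ∃ h : chart K n b ≤ t.left ⁻¹ᵁ chart K n a, ∀ j k, s j = k → coord t h j = ratio K n b k := by
  obtain ⟨t, ht⟩ := exists_hom_of_cover (projSpace K n) (fun a => chart K n (s a))
    (fun x => by
      obtain ⟨a, ha⟩ := exists_mem_chart x
      exact ⟨s.symm a, by rwa [Equiv.apply_symm_apply]⟩)
    (fun a j => ratio K n (s a) (s j)) (fun a => ratio_self _)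
    (fun a b j V ha hb => ratio_mul_ratio _ _ _ _ _ _)
  refine ⟨t, ?_⟩
  rintro a _ rfl
  obtain ⟨h, hj⟩ := ht a
  refine ⟨h, ?_⟩
  rintro j _ rfl
  exact hj j

theorem id_appLE_apply {X : Scheme.{u}} (U : X.Opens) (h : U ≤ 𝟙 X ⁻¹ᵁ U) (z : Γ(X, U)) :
    ((𝟙 X : X ⟶ X).appLE U U h).hom z = z := by
  have h1 : (𝟙 X : X ⟶ X).appLE U U h = 𝟙 _ := by
    rw [Scheme.Hom.appLE, Scheme.Hom.id_app]
    exact (Category.id_comp _).trans (X.presheaf.map_id (op U))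
  rw [h1]
  rfl

theorem coord_id {a : Fin n}
    (h : chart K n a ≤ (𝟙 (projSpace K n) : projSpace K n ⟶ _).left ⁻¹ᵁ chart K n a)
    (j : Fin n) : coord (𝟙 (projSpace K n)) h j = ratio K n a j :=
  id_appLE_apply (chart K n a) h _

theorem comp_eq_id_of_perm {s s' : Equiv.Perm (Fin n)} (hs : ∀ a, s (s' a) = a)
    {t t' : projSpace K n ⟶ projSpace K n}
    (ht : ∀ a b, s a = b → ∃ h : chart K n b ≤ t.left ⁻¹ᵁ chart K n a,
      ∀ j k, s j = k → coord t h j = ratio K n b k)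
    (ht' : ∀ a b, s' a = b → ∃ h : chart K n b ≤ t'.left ⁻¹ᵁ chart K n a,
      ∀ j k, s' j = k → coord t' h j = ratio K n b k) : t ≫ t' = 𝟙 _ := by
  refine hom_ext_of_coord _ _ fun x => ?_
  obtain ⟨a, ha⟩ := exists_mem_chart x
  obtain ⟨h', hj'⟩ := ht' a _ rfl
  obtain ⟨h, hj⟩ := ht (s' a) a (hs a)
  have hW : chart K n a ≤ t.left ⁻¹ᵁ (t'.left ⁻¹ᵁ chart K n a) := fun y hy => h' (h hy)
  refine ⟨chart K n a, a, hW, le_rfl, ha, fun j => ?_⟩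
  refine (coord_comp t' t h h' hW j).trans (Eq.trans ?_ (coord_id _ j).symm)
  rw [hj' j _ rfl]
  exact hj (s' j) j (hs j)

theorem exists_permIso (s : Equiv.Perm (Fin n)) :
    ∃ e : projSpace K n ≅ projSpace K n, ∀ x a, e.hom.left x ∈ chart K n a ↔
      x ∈ chart K n (s a) := by
  obtain ⟨t, ht⟩ := exists_permHom (K := K) s
  obtain ⟨t', ht'⟩ := exists_permHom (K := K) s.symm
  refine ⟨⟨t, t', comp_eq_id_of_perm s.apply_symm_apply ht ht',
    comp_eq_id_of_perm s.symm_apply_apply ht' ht⟩, fun x a => ?_⟩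
  obtain ⟨b, hb⟩ := exists_mem_chart x
  obtain ⟨h, hj⟩ := ht (s.symm b) b (s.apply_symm_apply b)
  have h1 := basicOpen_coord t h a
  rw [hj a _ rfl, basicOpen_ratio] at h1
  have h2 := SetLike.ext_iff.1 h1 x
  exact ⟨fun hx => (h2.2 ⟨hb, hx⟩).2, fun hx => (h2.1 ⟨hb, hx⟩).2⟩

/-- The coordinate automorphism pulls the cubic locus of the reindexed matrix back to that of `ω`,
so each shape need only be treated for one ordering of the indices. -/
theorem isPointVariety_of_perm {ω : Fin n → Fin n → K} (hω : ∀ i j, ω i j * ω j i = 1)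
    (hdiag : ∀ i, ω i i = 1) (s : Equiv.Perm (Fin n))
    {Z : TopologicalSpace.Closeds (projSpace K n).left}
    (hZ : IsCubicLocus (fun i j => ω (s i) (s j)) Z) :
    IsPointVariety (skewIdeal ω) (reducedOn (projSpace K n) Z) := by
  obtain ⟨e, he⟩ := exists_permIso (K := K) s
  let Z' : TopologicalSpace.Closeds (projSpace K n).left :=
    Z.preimage e.hom.left.continuous
  obtain ⟨e'⟩ := nonempty_iso_reducedOn e Z' Z fun x => Iff.rfl
  refine isPointVariety_of_isCubicLocus hω hdiag (Z := Z') (fun x => ?_) ⟨e'.symm⟩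
  refine (hZ (e.hom.left x)).trans ?_
  simp only [he]
  refine ⟨fun h i j k => ?_, fun h i j k => h (s i) (s j) (s k)⟩
  have := h (s.symm i) (s.symm j) (s.symm k)
  simpa only [qNumber, Equiv.apply_symm_apply] using this

/-! ### Projective space is reduced -/

/-- Stalks embed into localizations of a polynomial ring, which is a domain. -/
theorem isReduced_projSpace : AlgebraicGeometry.IsReduced (projSpace K n).left := by
  have h : ∀ x : Proj (grading K n), _root_.IsReduced ((Proj (grading K n)).presheaf.stalk x) := by
    intro x
    have h0 : x.asHomogeneousIdeal.toIdeal.IsPrime := x.isPrime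
    have h1 : _root_.IsReduced (Localization x.asHomogeneousIdeal.toIdeal.primeCompl) :=
      inferInstance
    have h2 : _root_.IsReduced
        (HomogeneousLocalization.AtPrime (grading K n) x.asHomogeneousIdeal.toIdeal) :=
      isReduced_of_injective (algebraMap _ (Localization x.asHomogeneousIdeal.toIdeal.primeCompl))
        (HomogeneousLocalization.val_injective _)
    exact isReduced_of_injective (Proj.stalkIso (grading K n) x).hom.hom
      (Proj.stalkIso (grading K n) x).commRingCatIsoToRingEquiv.injective
  exact @isReduced_of_isReduced_stalk (Proj (grading K n)) h

end SkewProj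

namespace SkewProj

variable {K : Type u} [Field K]

/-! ### The cubic loci in three-dimensional projective space -/

theorem mem_linearLocus {n : ℕ} {s : Set (Fin n)} {x : (projSpace K n).left} :
    x ∈ linearLocus s ↔ ∀ j ∈ s, x ∉ chart K n j := by
  have h : ∀ j, x ∉ chart K n j ↔
      MvPolynomial.X j ∈ ProjectiveSpectrum.asHomogeneousIdeal (𝒜 := grading K n) x :=
    fun j => not_not
  simp only [h]
  exact Set.image_subset_iff

theorem mem_closeds_sup {X : Type*} [TopologicalSpace X] {A B : TopologicalSpace.Closeds X} {x : X} :
    x ∈ A ⊔ B ↔ x ∈ A ∨ x ∈ B := Iff.rfl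

section

variable {n : ℕ} {ω : Fin n → Fin n → K}

theorem qNumber_rotate (i j k : Fin n) : qNumber ω j k i = qNumber ω i j k := by
  simp only [qNumber]
  ring

theorem qNumber_mul_swap (hω : ∀ i j, ω i j * ω j i = 1) (i j k : Fin n) :
    qNumber ω j i k * qNumber ω i j k = 1 := by
  simp only [qNumber]
  linear_combination (ω i k * ω k i * (ω j k * ω k j)) * hω i j + ω j k * ω k j * hω i k + hω j k

theorem qNumber_swap_eq_one (hω : ∀ i j, ω i j * ω j i = 1) (i j k : Fin n) :
    qNumber ω j i k = 1 ↔ qNumber ω i j k = 1 := by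
  have h := qNumber_mul_swap hω i j k
  constructor <;> intro h1 <;> simpa [h1] using h

theorem qNumber_self (hω : ∀ i j, ω i j * ω j i = 1) (hdiag : ∀ i, ω i i = 1) (i j : Fin n) :
    qNumber ω i i j = 1 := by
  rw [qNumber, hdiag, one_mul, hω]

/-- After cancelling $\omega_{jl}\omega_{lj}$ and $\omega_{ik}\omega_{ki}$, both sides are
$\omega_{ij}\omega_{jk}\omega_{kl}\omega_{li}$. Consequently, if three of the four $q$'s are $1$, so
is the fourth. -/
theorem qNumber_mul_qNumber (hω : ∀ i j, ω i j * ω j i = 1) (i j k l : Fin n) :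
    qNumber ω j k l * qNumber ω i j l = qNumber ω i j k * qNumber ω i k l := by
  simp only [qNumber]
  linear_combination (ω i j * ω j k * ω k l * ω l i) * (hω j l - hω i k)

end

variable {ω : Fin 4 → Fin 4 → K}

/-- A repeated index makes $q=1$, and a permutation of the indices replaces $q$ by $q^{\pm1}$, so
only the four 3-subsets impose conditions. -/
theorem isCubicLocus_four_iff (hω : ∀ i j, ω i j * ω j i = 1) (hdiag : ∀ i, ω i i = 1)
    (P : Fin 4 → Prop) :
    (∀ i j k, qNumber ω i j k ≠ 1 → ¬ (P i ∧ P j ∧ P k)) ↔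
      (qNumber ω 0 1 2 ≠ 1 → ¬ (P 0 ∧ P 1 ∧ P 2)) ∧ (qNumber ω 0 1 3 ≠ 1 → ¬ (P 0 ∧ P 1 ∧ P 3)) ∧
      (qNumber ω 0 2 3 ≠ 1 → ¬ (P 0 ∧ P 2 ∧ P 3)) ∧
      (qNumber ω 1 2 3 ≠ 1 → ¬ (P 1 ∧ P 2 ∧ P 3)) := by
  refine ⟨fun h => ⟨h _ _ _, h _ _ _, h _ _ _, h _ _ _⟩, fun ⟨h1, h2, h3, h4⟩ => ?_⟩
  let Φ : Fin 4 → Fin 4 → Fin 4 → Prop := fun i j k => qNumber ω i j k ≠ 1 → ¬ (P i ∧ P j ∧ P k)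
  have rot : ∀ {i j k}, Φ i j k → Φ j k i := fun h hq hP =>
    h (by rwa [qNumber_rotate] at hq) ⟨hP.2.2, hP.1, hP.2.1⟩
  have swap : ∀ {i j k}, Φ i j k → Φ j i k := fun h hq hP =>
    h (by rwa [Ne, qNumber_swap_eq_one hω] at hq) ⟨hP.2.1, hP.1, hP.2.2⟩
  have self : ∀ i j, Φ i i j := fun i j hq => (hq (qNumber_self hω hdiag i j)).elim
  have perm : ∀ {i j k}, Φ i j k → ∀ i' j' k', (i' = i ∧ j' = j ∧ k' = k) ∨
      (i' = j ∧ j' = k ∧ k' = i) ∨ (i' = k ∧ j' = i ∧ k' = j) ∨ (i' = j ∧ j' = i ∧ k' = k) ∨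
      (i' = i ∧ j' = k ∧ k' = j) ∨ (i' = k ∧ j' = j ∧ k' = i) → Φ i' j' k' := by
    rintro i j k h i' j' k' (⟨rfl, rfl, rfl⟩ | ⟨rfl, rfl, rfl⟩ | ⟨rfl, rfl, rfl⟩ | ⟨rfl, rfl, rfl⟩ |
      ⟨rfl, rfl, rfl⟩ | ⟨rfl, rfl, rfl⟩)
    exacts [h, rot h, rot (rot h), swap h, rot (swap h), rot (rot (swap h))]
  intro i j k
  change Φ i j k
  by_cases hij : i = j
  · subst hij
    exact self i k
  by_cases hjk : j = k
  · subst hjk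
    exact rot (rot (self j i))
  by_cases hik : i = k
  · subst hik
    exact rot (self i j)
  fin_cases i <;> fin_cases j <;> fin_cases k <;> first
    | exact (hij rfl).elim
    | exact (hjk rfl).elim
    | exact (hik rfl).elim
    | exact perm h1 _ _ _ (by decide)
    | exact perm h2 _ _ _ (by decide)
    | exact perm h3 _ _ _ (by decide)
    | exact perm h4 _ _ _ (by decide)

variable (hω : ∀ i j, ω i j * ω j i = 1) (hdiag : ∀ i, ω i i = 1)

include hω hdiag

theorem isPointVariety_projSpace (h₁ : qNumber ω 0 1 2 = 1) (h₂ : qNumber ω 0 1 3 = 1)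
    (h₃ : qNumber ω 0 2 3 = 1) : IsPointVariety (skewIdeal ω) (projSpace K 4) := by
  obtain ⟨e⟩ := nonempty_iso_reducedOn_top (X := projSpace K 4) isReduced_projSpace
  refine isPointVariety_of_isCubicLocus hω hdiag (Z := ⊤) (fun x => ?_) ⟨e.symm⟩
  have h₄ := qNumber_mul_qNumber hω 0 1 2 3
  rw [h₁, h₂, h₃, mul_one, mul_one] at h₄
  rw [isCubicLocus_four_iff hω hdiag fun i => x ∈ chart K 4 i]
  exact ⟨fun _ => by simp [h₁, h₂, h₃, h₄], fun _ => trivial⟩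

/-- Here $i,j$ are the indices shared by the two trivial triples. The surviving cubics $x_ix_kx_l$
and $x_jx_kx_l$ vanish when $x_k=0$, $x_l=0$ or $x_i=x_j=0$. -/
theorem isPointVariety_line_two_hyperplanes (i j k l : Fin 4)
    (hs : Function.Bijective ![i, j, k, l]) (h₁ : qNumber ω i j k = 1) (h₂ : qNumber ω i j l = 1)
    (h₃ : qNumber ω i k l ≠ 1) : IsPointVariety (skewIdeal ω)
      (reducedOn (projSpace K 4) (linearLocus {0, 1} ⊔ linearLocus {2} ⊔ linearLocus {3})) := by
  refine isPointVariety_of_perm hω hdiag (Equiv.ofBijective _ hs) fun x => ?_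
  have h₄ := qNumber_mul_qNumber hω i j k l
  rw [h₁, h₂, mul_one, one_mul] at h₄
  rw [← h₄] at h₃
  rw [isCubicLocus_four_iff (fun _ _ => hω _ _) (fun _ => hdiag _) fun i => x ∈ chart K 4 i]
  simp only [mem_closeds_sup, mem_linearLocus]
  simp only [qNumber, Equiv.ofBijective_apply, Matrix.cons_val] at *
  simp only [Set.mem_insert_iff, Set.mem_singleton_iff, forall_eq_or_imp, forall_eq]
  grind

/-- The index $i$ is the one missing from the trivial triple: either $x_i=0$, or no two of
$x_j,x_k,x_l$ are nonzero. -/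
theorem isPointVariety_hyperplane_three_lines (i j k l : Fin 4)
    (hs : Function.Bijective ![i, j, k, l]) (h₁ : qNumber ω i j k ≠ 1) (h₂ : qNumber ω i j l ≠ 1)
    (h₃ : qNumber ω i k l ≠ 1) (h₄ : qNumber ω j k l = 1) : IsPointVariety (skewIdeal ω)
      (reducedOn (projSpace K 4) (linearLocus {0} ⊔ linearLocus {1, 2} ⊔ linearLocus {1, 3} ⊔
        linearLocus {2, 3})) := by
  refine isPointVariety_of_perm hω hdiag (Equiv.ofBijective _ hs) fun x => ?_
  rw [isCubicLocus_four_iff (fun _ _ => hω _ _) (fun _ => hdiag _) fun i => x ∈ chart K 4 i]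
  simp only [mem_closeds_sup, mem_linearLocus]
  simp only [qNumber, Equiv.ofBijective_apply, Matrix.cons_val] at *
  simp only [Set.mem_insert_iff, Set.mem_singleton_iff, forall_eq_or_imp, forall_eq]
  grind

/-- A point with a zero among any three coordinates has at least two zero coordinates. -/
theorem isPointVariety_six_lines (h₁ : qNumber ω 0 1 2 ≠ 1) (h₂ : qNumber ω 0 1 3 ≠ 1)
    (h₃ : qNumber ω 0 2 3 ≠ 1) (h₄ : qNumber ω 1 2 3 ≠ 1) : IsPointVariety (skewIdeal ω)
      (reducedOn (projSpace K 4) (linearLocus {0, 1} ⊔ linearLocus {0, 2} ⊔ linearLocus {0, 3} ⊔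
        linearLocus {1, 2} ⊔ linearLocus {1, 3} ⊔ linearLocus {2, 3})) := by
  refine isPointVariety_of_isCubicLocus hω hdiag (fun x => ?_) ⟨Iso.refl _⟩
  rw [isCubicLocus_four_iff hω hdiag fun i => x ∈ chart K 4 i]
  simp only [mem_closeds_sup, mem_linearLocus]
  simp only [Set.mem_insert_iff, Set.mem_singleton_iff, forall_eq_or_imp, forall_eq]
  grind

end SkewProj

end

/-! ### The case distinction on the cyclic q-numbers -/

theorem mainTheorem5 {K : Type u} [Field K] [IsAlgClosed K] [CharZero K]
    (ω : Fin 4 → Fin 4 → K) (hω : ∀ i j, ω i j * ω j i = 1) (hdiag : ∀ i, ω i i = 1)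
    (q₁₂₃ q₁₂₄ q₁₃₄ : K) (h₁₂₃ : q₁₂₃ = SkewProj.qNumber ω 0 1 2)
    (h₁₂₄ : q₁₂₄ = SkewProj.qNumber ω 0 1 3) (h₁₃₄ : q₁₃₄ = SkewProj.qNumber ω 0 2 3) :
    (q₁₂₃ = 1 ∧ q₁₂₄ = 1 ∧ q₁₃₄ = 1 →
      SkewProj.IsPointVariety (SkewProj.skewIdeal ω) (SkewProj.projSpace K 4)) ∧
    (SkewProj.LineTwoHyperplanes q₁₂₃ q₁₂₄ q₁₃₄ →
      SkewProj.IsPointVariety (SkewProj.skewIdeal ω)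
        (SkewProj.reducedOn (SkewProj.projSpace K 4)
          (SkewProj.linearLocus {0, 1} ⊔ SkewProj.linearLocus {2} ⊔
            SkewProj.linearLocus {3}))) ∧
    (SkewProj.HyperplaneThreeLines q₁₂₃ q₁₂₄ q₁₃₄ →
      SkewProj.IsPointVariety (SkewProj.skewIdeal ω)
        (SkewProj.reducedOn (SkewProj.projSpace K 4)
          (SkewProj.linearLocus {0} ⊔ SkewProj.linearLocus {1, 2} ⊔
            SkewProj.linearLocus {1, 3} ⊔ SkewProj.linearLocus {2, 3}))) ∧
    (¬ (q₁₂₃ = 1 ∧ q₁₂₄ = 1 ∧ q₁₃₄ = 1) ∧ ¬ SkewProj.LineTwoHyperplanes q₁₂₃ q₁₂₄ q₁₃₄ ∧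
        ¬ SkewProj.HyperplaneThreeLines q₁₂₃ q₁₂₄ q₁₃₄ →
      SkewProj.IsPointVariety (SkewProj.skewIdeal ω)
        (SkewProj.reducedOn (SkewProj.projSpace K 4)
          (SkewProj.linearLocus {0, 1} ⊔ SkewProj.linearLocus {0, 2} ⊔
            SkewProj.linearLocus {0, 3} ⊔ SkewProj.linearLocus {1, 2} ⊔
            SkewProj.linearLocus {1, 3} ⊔ SkewProj.linearLocus {2, 3}))) := by
  subst h₁₂₃ h₁₂₄ h₁₃₄
  have h₂₃₄ := SkewProj.qNumber_mul_qNumber hω 0 1 2 3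
  have rot := fun i j k => SkewProj.qNumber_rotate (ω := ω) i j k
  have swap := fun i j k => SkewProj.qNumber_swap_eq_one hω i j k
  have h021 : SkewProj.qNumber ω 0 2 1 = 1 ↔ SkewProj.qNumber ω 0 1 2 = 1 := by
    rw [rot 1 0 2, swap]
  have h031 : SkewProj.qNumber ω 0 3 1 = 1 ↔ SkewProj.qNumber ω 0 1 3 = 1 := by
    rw [rot 1 0 3, swap]
  have h032 : SkewProj.qNumber ω 0 3 2 = 1 ↔ SkewProj.qNumber ω 0 2 3 = 1 := by
    rw [rot 2 0 3, swap]
  have h103 := swap 0 1 3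
  have h102 := swap 0 1 2
  have h203 := swap 0 2 3
  have h120 := rot 0 1 2
  have h130 := rot 0 1 3
  have h230 := rot 0 2 3
  have h301 := (rot 3 0 1).symm
  have h302 := (rot 3 0 2).symm
  have h231 := rot 1 2 3
  have h132 : SkewProj.qNumber ω 1 3 2 = 1 ↔ SkewProj.qNumber ω 1 2 3 = 1 := by
    rw [rot 2 1 3, swap]
  have h213 := swap 1 2 3
  -- Nonvanishing allows cancellation in the cocycle identity, which turns the conditions on three
  -- $q$'s into the value of $q_{(234)}$.
  have hne : ∀ i j k, SkewProj.qNumber ω i j k ≠ 0 := fun i j k =>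
    right_ne_zero_of_mul_eq_one (SkewProj.qNumber_mul_swap hω i j k)
  have hA := hne 0 1 2
  have hB := hne 0 1 3
  have hC := hne 0 2 3
  refine ⟨fun ⟨h1, h2, h3⟩ => SkewProj.isPointVariety_projSpace hω hdiag h1 h2 h3, ?_, ?_, ?_⟩
  -- In each case exactly two triples are trivial; the first two indices chosen are those they
  -- share. In the last three cases one of these triples is $(234)$.
  · rintro (h | h | h | h | h | h)
    · exact SkewProj.isPointVariety_line_two_hyperplanes hω hdiag 0 1 2 3 (by decide)
        (by grind) (by grind) (by grind)
    · exact SkewProj.isPointVariety_line_two_hyperplanes hω hdiag 0 2 1 3 (by decide)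
        (by grind) (by grind) (by grind)
    · exact SkewProj.isPointVariety_line_two_hyperplanes hω hdiag 0 3 1 2 (by decide)
        (by grind) (by grind) (by grind)
    · exact SkewProj.isPointVariety_line_two_hyperplanes hω hdiag 1 2 0 3 (by decide)
        (by grind) (by grind) (by grind)
    · exact SkewProj.isPointVariety_line_two_hyperplanes hω hdiag 1 3 0 2 (by decide)
        (by grind) (by grind) (by grind)
    · exact SkewProj.isPointVariety_line_two_hyperplanes hω hdiag 2 3 0 1 (by decide)
        (by grind) (by grind) (by grind)
  -- Exactly one triple is trivial, and the index it omits is placed first.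
  · rintro (h | h | h | h)
    · exact SkewProj.isPointVariety_hyperplane_three_lines hω hdiag 3 0 1 2 (by decide)
        (by grind) (by grind) (by grind) (by grind)
    · exact SkewProj.isPointVariety_hyperplane_three_lines hω hdiag 2 0 1 3 (by decide)
        (by grind) (by grind) (by grind) (by grind)
    · exact SkewProj.isPointVariety_hyperplane_three_lines hω hdiag 1 0 2 3 (by decide)
        (by grind) (by grind) (by grind) (by grind)
    · exact SkewProj.isPointVariety_hyperplane_three_lines hω hdiag 0 1 2 3 (by decide)
        (by grind) (by grind) (by grind) (by grind)
  -- If any of the four $q$'s were $1$, the cocycle identity would put the triple of parameters in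
  -- one of the excluded cases.
  · rintro ⟨h1, h2, h3⟩
    rw [SkewProj.LineTwoHyperplanes] at h2
    rw [SkewProj.HyperplaneThreeLines] at h3
    exact SkewProj.isPointVariety_six_lines hω hdiag (by grind) (by grind) (by grind) (by grind)
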